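/- A simple graph on $n\ge 3$ vertices is called pancyclic if it contains a cycle of length $\ell$ for every integer $\ell$ with $3\le \ell\le n$. Let $m(n)$ be the minimum number of edges of a pancyclic graph on $n$ vertices. Then for $3\le n\le 37$ the exact value is $m(n)=n+k$, where $$k=\begin{cases}0, & n=3,\\ 1, & 4\le n\le 5,\\ 2, & 6\le n\le 8,\\ 3, & 9\le n\le 14,\\ 4, & 15\le n\le 24,\\ 5, & 25\le n\le 37.\end{cases}$$ Moreover, for every $21\le n\le 37$ the graph on the vertices $0,1,\dots,n-1$ that consists of the cycle $0,1,\dots,n-1,0$ and the five chords $\{0,2\}$, $\{1,7\}$, $\{3,6\}$, $\{4,12\}$, $\{8,21\}$ (where, for $n=21$, the vertex $21$ is read as $0$) is pancyclic and has exactly $n+5$ edges. -/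

import Mathlib

/-- A finite simple graph on `n` vertices is pancyclic if it has a cycle of every length `ℓ`
with `3 ≤ ℓ ≤ n`. -/
def IsPancyclic {V : Type*} [Fintype V] (G : SimpleGraph V) : Prop :=
  ∀ ℓ : ℕ, 3 ≤ ℓ → ℓ ≤ Fintype.card V →
    ∃ (v : V) (p : G.Walk v v), p.IsCycle ∧ p.length = ℓ

/-- `m(n)`: the minimum number of edges of a pancyclic graph on `n` vertices.
The complete graph is pancyclic, so this is the infimum of a nonempty set of natural
numbers, hence a minimum. -/
noncomputable def minPancyclicEdges (n : ℕ) : ℕ :=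
  sInf {e : ℕ | ∃ G : SimpleGraph (Fin n), IsPancyclic G ∧ G.edgeSet.ncard = e}

/-- The construction with five chords: the cycle `0, 1, …, n - 1` together with the chords
`{0, 2}`, `{1, 7}`, `{3, 6}`, `{4, 12}`, `{8, 21}`. It is meant for `n ≥ 21`; the path from
vertex `21` on to vertex `0` has `x = n - 21` edges, so that `21` is read as `0` for `n = 21`. -/
def fiveChordGraph (n : ℕ) : SimpleGraph (Fin n) :=
  SimpleGraph.fromRel fun u v =>
    (v : ℕ) = ((u : ℕ) + 1) % n ∨
      ((u : ℕ), (v : ℕ)) ∈ [(0, 2), (1, 7), (3, 6), (4, 12), (8, 21 % n)]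

/-! A pancyclic graph on n vertices has a Hamiltonian cycle, so it has n + k edges, where k counts
the chords of that cycle. The question is how few chords can produce all lengths. The upper bounds
come from explicit lists of chords, whose cycle lengths are found by exhaustive path search
(`allLengths`, `isPancyclic_chordGraph`).

For the lower bound, note that a cycle has even degree at every vertex. Along the Hamiltonian cycle,
membership in the given cycle therefore flips exactly at the vertices where an odd number of its
chords end, so its set S of chords and its state on one edge determine it (`eq_xor_covering`). Hence
k chords give at most 2(2^k - 1) cycles besides the Hamiltonian one, and these must supply the n - 3
lengths from 3 to n - 1. Counting alone settles k = 1; for k = 2, 3, 4 it only gives n ≤ 9, 17, 33.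

The rest depends only on the order of the 2k chord ends, a perfect matching of 0, …, 2k - 1, and on
the 2k gaps between consecutive ends. A candidate has length |S| plus a sum of selected gaps. Ends
at the same vertex are separated by a gap of length zero, with ties ordered so that chords sharing a
vertex do not cross. The labelling is rotated to make the last gap the largest. `exists_chordSystem`
extracts this data from a graph, and `ChordSystem.exists_feasible` passes to matchings and gaps.

For each matching, `node` backtracks over the gaps: some candidate must have the smallest missing
length, so every candidate is tried, with every distribution of the remaining length over its
unknown gaps. The pruning quantity is the slack, the number of candidates in excess of the missing
lengths; a candidate that repeats a length or cannot be a cycle costs one unit. Soundness is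
one-sided: a genuine configuration forces the answer `true` (`node_sound`, `feasible_of_realizes`),
so an evaluation to `false` in the kernel excludes all configurations. Gaps are packed as base-256
digits, so that selecting gaps is a bitwise "and", and adding them up is a remainder modulo 255. -/

namespace Pancyclic

open Finset

/-! ### Base-256 packing -/

/-- The number with base-256 digits `f 0, …, f (N - 1)`. -/
def pack (f : ℕ → ℕ) (N : ℕ) : ℕ :=
  Nat.rec 0 (fun r ih => Nat.add ih (Nat.mul (f r) (Nat.pow 256 r))) N

theorem pack_succ (f : ℕ → ℕ) (N : ℕ) : pack f (N + 1) = pack f N + f N * 256 ^ N := rfl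

theorem pack_eq_sum (f : ℕ → ℕ) (N : ℕ) : pack f N = ∑ r ∈ range N, f r * 256 ^ r := by
  induction N with
  | zero => rfl
  | succ N ih => rw [pack_succ, ih, sum_range_succ]

theorem pack_congr {f g : ℕ → ℕ} {N : ℕ} (h : ∀ r < N, f r = g r) : pack f N = pack g N := by
  rw [pack_eq_sum, pack_eq_sum]
  exact sum_congr rfl fun r hr => by rw [h r (mem_range.1 hr)]

theorem pack_lt {f : ℕ → ℕ} {N : ℕ} (hf : ∀ r < N, f r < 256) : pack f N < 256 ^ N := by
  induction N with
  | zero => simp [pack]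
  | succ N ih =>
    have h1 := ih fun r hr => hf r (by omega)
    have h2 := hf N (by omega)
    have h3 : f N * 256 ^ N ≤ 255 * 256 ^ N := Nat.mul_le_mul_right _ (by omega)
    rw [pack_succ, pow_succ]
    omega

/-- Since 256 ^ N = 2 ^ (8 * N), the digits occupy disjoint blocks of eight bits. This is why
bitwise operations act digit by digit. -/
theorem pack_testBit {f : ℕ → ℕ} {N : ℕ} (hf : ∀ r < N + 1, f r < 256) (j : ℕ) :
    (pack f (N + 1)).testBit j =
      if j < 8 * N then (pack f N).testBit j else (f N).testBit (j - 8 * N) := by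
  have h := pack_lt (f := f) (N := N) fun r hr => hf r (by omega)
  have h256 : (256 : ℕ) ^ N = 2 ^ (8 * N) := by rw [pow_mul]; norm_num
  rw [h256] at h
  rw [pack_succ, h256, add_comm, mul_comm, Nat.testBit_two_pow_mul_add _ h]

theorem pack_land {f g : ℕ → ℕ} {N : ℕ} (hf : ∀ r < N, f r < 256) (hg : ∀ r < N, g r < 256) :
    pack f N &&& pack g N = pack (fun r => f r &&& g r) N := by
  induction N with
  | zero => simp [pack]
  | succ N ih =>
    refine Nat.eq_of_testBit_eq fun j => ?_
    have hfg : ∀ r < N + 1, f r &&& g r < 256 := fun r hr =>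
      lt_of_le_of_lt Nat.and_le_left (hf r hr)
    rw [Nat.testBit_and, pack_testBit hf, pack_testBit hg, pack_testBit hfg,
      ← ih (fun r hr => hf r (by omega)) (fun r hr => hg r (by omega))]
    split_ifs <;> simp

theorem pack_xor {f g : ℕ → ℕ} {N : ℕ} (hf : ∀ r < N, f r < 256) (hg : ∀ r < N, g r < 256) :
    pack f N ^^^ pack g N = pack (fun r => f r ^^^ g r) N := by
  induction N with
  | zero => simp [pack]
  | succ N ih =>
    refine Nat.eq_of_testBit_eq fun j => ?_
    have hfg : ∀ r < N + 1, f r ^^^ g r < 256 := fun r hr =>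
      Nat.xor_lt_two_pow (n := 8) (hf r hr) (hg r hr)
    rw [Nat.testBit_xor, pack_testBit hf, pack_testBit hg, pack_testBit hfg,
      ← ih (fun r hr => hf r (by omega)) (fun r hr => hg r (by omega))]
    split_ifs <;> simp

theorem pack_inj {f g : ℕ → ℕ} {N : ℕ} (hf : ∀ r < N, f r < 256) (hg : ∀ r < N, g r < 256)
    (h : pack f N = pack g N) : ∀ r < N, f r = g r := by
  induction N with
  | zero => intro r hr; omega
  | succ N ih =>
    have h1 := pack_lt (f := f) (N := N) fun r hr => hf r (by omega)
    have h2 := pack_lt (f := g) (N := N) fun r hr => hg r (by omega)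
    rw [pack_succ, pack_succ] at h
    have h3 : f N = g N := by
      have := congrArg (· / 256 ^ N) h
      simpa [Nat.add_mul_div_right, Nat.div_eq_of_lt h1, Nat.div_eq_of_lt h2] using this
    rw [h3] at h
    intro r hr
    rcases Nat.lt_succ_iff_lt_or_eq.1 hr with hr | rfl
    · exact ih (fun r hr => hf r (by omega)) (fun r hr => hg r (by omega)) (by omega) r hr
    · exact h3

/-- Casting out 255: 256 is congruent to 1, so the number is congruent to its digit sum, and the
bound makes the remainder equal to it. -/
theorem pack_mod {f : ℕ → ℕ} {N : ℕ} (hf : ∑ r ∈ range N, f r < 255) :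
    pack f N % 255 = ∑ r ∈ range N, f r := by
  have h : pack f N ≡ ∑ r ∈ range N, f r [MOD 255] := by
    rw [pack_eq_sum]
    clear hf
    induction N with
    | zero => rfl
    | succ N ih =>
      rw [sum_range_succ, sum_range_succ]
      refine ih.add ?_
      have h1 : 256 ^ N ≡ 1 [MOD 255] := by simpa using (show 256 ≡ 1 [MOD 255] from rfl).pow N
      simpa using h1.mul_left (f N)
  exact Nat.mod_eq_of_modEq h hf

/-- The mask with digit 255 at the places selected by `β`. -/
def mask (β : ℕ → Bool) (N : ℕ) : ℕ := pack (fun r => cond (β r) 255 0) N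

/-- The packing of `h` restricted to the places selected by `β`. -/
def sel (h : ℕ → ℕ) (β : ℕ → Bool) (N : ℕ) : ℕ := pack (fun r => cond (β r) (h r) 0) N

/-- The sum of `h` over the places selected by `β`. -/
def wt (h : ℕ → ℕ) (β : ℕ → Bool) (N : ℕ) : ℕ := ∑ r ∈ range N, cond (β r) (h r) 0

theorem cond_lt {b : Bool} {x y : ℕ} (hx : x < y) : cond b x 0 < y := by
  cases b
  · exact lt_of_le_of_lt (Nat.zero_le _) hx
  · exact hx

theorem mask_land (β γ : ℕ → Bool) (N : ℕ) :
    mask β N &&& mask γ N = mask (fun r => β r && γ r) N := by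
  unfold mask
  rw [pack_land (fun r _ => cond_lt (by norm_num)) (fun r _ => cond_lt (by norm_num))]
  refine pack_congr fun r _ => ?_
  dsimp only
  cases β r <;> cases γ r <;> simp

theorem mask_xor (β γ : ℕ → Bool) (N : ℕ) :
    mask β N ^^^ mask γ N = mask (fun r => xor (β r) (γ r)) N := by
  unfold mask
  rw [pack_xor (fun r _ => cond_lt (by norm_num)) (fun r _ => cond_lt (by norm_num))]
  refine pack_congr fun r _ => ?_
  dsimp only
  cases β r <;> cases γ r <;> simp

theorem mask_congr {β γ : ℕ → Bool} {N : ℕ} (h : ∀ r < N, β r = γ r) : mask β N = mask γ N :=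
  pack_congr fun r hr => by rw [h r hr]

theorem mask_inj {β γ : ℕ → Bool} {N : ℕ} (h : mask β N = mask γ N) : ∀ r < N, β r = γ r := by
  intro r hr
  have := pack_inj (fun r _ => cond_lt (by norm_num)) (fun r _ => cond_lt (by norm_num)) h r hr
  revert this
  cases β r <;> cases γ r <;> simp

theorem mask_false (N : ℕ) : mask (fun _ => false) N = 0 := by
  simp [mask, pack_eq_sum]

theorem mask_eq_zero {β : ℕ → Bool} {N : ℕ} (h : mask β N = 0) : ∀ r < N, β r = false :=
  mask_inj (h.trans (mask_false N).symm)

/-- The digit 255 has all eight bits set, so "and" with a mask keeps or erases each digit as a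
whole. -/
theorem sel_land {h : ℕ → ℕ} {N : ℕ} (hh : ∀ r < N, h r < 256) (β γ : ℕ → Bool) :
    sel h β N &&& mask γ N = sel h (fun r => β r && γ r) N := by
  unfold mask sel
  rw [pack_land (fun r hr => cond_lt (hh r hr)) (fun r _ => cond_lt (by norm_num))]
  refine pack_congr fun r hr => ?_
  have h255 : h r &&& 255 = h r := by
    rw [show (255 : ℕ) = 2 ^ 8 - 1 from rfl, Nat.and_two_pow_sub_one_eq_mod]
    exact Nat.mod_eq_of_lt (hh r hr)
  dsimp only
  cases β r <;> cases γ r <;> simp [h255]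

theorem wt_le (h : ℕ → ℕ) (β : ℕ → Bool) (N : ℕ) : wt h β N ≤ ∑ r ∈ range N, h r :=
  sum_le_sum fun r _ => by cases β r <;> simp

theorem wt_congr {h : ℕ → ℕ} {β γ : ℕ → Bool} {N : ℕ} (hβ : ∀ r < N, β r = γ r) :
    wt h β N = wt h γ N :=
  sum_congr rfl fun r hr => by rw [hβ r (mem_range.1 hr)]

theorem sel_mod {h : ℕ → ℕ} {N : ℕ} (hh : ∑ r ∈ range N, h r < 255) (β : ℕ → Bool) :
    sel h β N % 255 = wt h β N :=
  pack_mod (lt_of_le_of_lt (wt_le h β N) hh)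

theorem lt_of_sum_lt {h : ℕ → ℕ} {N : ℕ} (hh : ∑ r ∈ range N, h r < 255) : ∀ r < N, h r < 256 :=
  fun r hr => by
    have := single_le_sum (f := h) (fun i _ => Nat.zero_le _) (mem_range.2 hr)
    omega

theorem mask_single {N i : ℕ} (hi : i < N) : mask (fun r => Nat.beq r i) N = 255 * 256 ^ i := by
  rw [mask, pack_eq_sum, sum_eq_single i]
  · simp
  · intro r _ hr
    have : Nat.beq r i = false := by rw [← Bool.not_eq_true, Nat.beq_eq]; exact hr
    simp [this]
  · intro h
    exact absurd (mem_range.2 hi) h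

/-- The mask of an interval of places. -/
theorem mask_Ico {A B N : ℕ} (hAB : A ≤ B) (hBN : B ≤ N) :
    mask (fun r => Nat.ble A r && Nat.blt r B) N = 256 ^ B - 256 ^ A := by
  have h1 : ∀ m, ∑ r ∈ range m, 255 * 256 ^ r + 1 = 256 ^ m := by
    intro m
    induction m with
    | zero => rfl
    | succ m ih => rw [sum_range_succ, pow_succ]; omega
  have h2 : mask (fun r => Nat.ble A r && Nat.blt r B) N = ∑ r ∈ Ico A B, 255 * 256 ^ r := by
    rw [mask, pack_eq_sum]
    have hsub : Ico A B ⊆ range N := fun r hr => by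
      have := mem_Ico.1 hr
      exact mem_range.2 (by omega)
    rw [← sum_subset hsub]
    · refine sum_congr rfl fun r hr => ?_
      have := mem_Ico.1 hr
      have e1 : Nat.ble A r = true := Nat.ble_eq.mpr this.1
      have e2 : Nat.blt r B = true := Nat.blt_eq.mpr this.2
      simp [e1, e2]
    · intro r _ hr
      have : ¬ (A ≤ r ∧ r < B) := fun h => hr (mem_Ico.2 h)
      have e : (Nat.ble A r && Nat.blt r B) = false := by
        rw [Bool.and_eq_false_iff, ← Bool.not_eq_true, ← Bool.not_eq_true, Nat.ble_eq, Nat.blt_eq]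
        tauto
      simp [e]
  have h3 := sum_range_add_sum_Ico (fun r => 255 * 256 ^ r) hAB
  have h4 := h1 A
  have h5 := h1 B
  rw [h2]
  omega


/-! ### The search -/

/-- A candidate cycle: its length is `s` plus the sum of the gaps in the mask `M`, and it is a cycle
only if the gaps with masks in `zs` are nonzero. -/
structure Cand where
  s : ℕ
  M : ℕ
  zs : List ℕ
  deriving Inhabited

/-- Evaluate `x` to a literal before it is passed on: the kernel reduces by name. -/
def force {α : Type} (x : ℕ) (k : ℕ → α) : α := Nat.rec (k 0) (fun m _ => k (Nat.succ m)) x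

theorem force_eq {α : Type} (x : ℕ) (k : ℕ → α) : force x k = k x := by cases x <;> rfl

/-- Some gap in the list is known (not in `U`) to be zero. -/
def blocked (G U : ℕ) : List ℕ → Bool :=
  List.rec false fun z _ ih =>
    cond (Nat.beq (Nat.land U z) 0) (cond (Nat.beq (Nat.land G z) 0) true ih) ih

/-- Lower `slack` by one, or fail. -/
def spend (k : ℕ → Bool) (slack : ℕ) : Bool := Nat.rec false (fun m _ => k m) slack

/-- Record the length `x` in the bit set `det`; a length that was there already costs slack. -/
def record (k : ℕ → ℕ → Bool) (det slack x : ℕ) : Bool :=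
  force (Nat.shiftLeft 1 x) fun b =>
    cond (Nat.beq (Nat.land det b) 0) (force (Nat.lor det b) fun d => k d slack)
      (spend (fun m => k det m) slack)

/-- Go through the candidates: drop those that are blocked, record the lengths of those that are
determined, and collect the others. -/
def scan (G U rest : ℕ) (k : ℕ → ℕ → List Cand → Bool) : List Cand → ℕ → ℕ → List Cand → Bool :=
  List.rec (fun det slack acc => k det slack acc) fun c _ ih det slack acc =>
    cond (blocked G U c.zs) (spend (fun m => ih det m acc) slack) <|
      force (Nat.land c.M U) fun t =>
        cond (Nat.beq t 0)
          (record (fun d m => ih d m acc) det slack (Nat.add c.s (Nat.mod (Nat.land G c.M) 255)))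
          -- A candidate that contains all the unknown gaps is determined as well, because these add
          -- up to `rest`.
          (cond (Nat.beq t U)
            (record (fun d m => ih d m acc) det slack
              (Nat.add (Nat.add c.s (Nat.mod (Nat.land G c.M) 255)) rest))
            (ih det slack (c :: acc)))

/-- Some `v ≤ m` satisfies `f`. -/
def anyLE (f : ℕ → Bool) : ℕ → Bool :=
  Nat.rec (f 0) fun m ih => cond (f (Nat.succ m)) true ih

/-- Try all ways to write `rem` as the sum of the gaps at the places `b` of the list. -/
def assign (k : ℕ → ℕ → Bool) : List ℕ → ℕ → ℕ → ℕ → Bool :=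
  List.rec (fun _ G U => k G U) fun b t ih rem G U =>
    force (Nat.sub U (Nat.mul 255 b)) fun U' =>
      List.rec (force (Nat.add G (Nat.mul rem b)) fun G' => k G' U')
        (fun _ _ _ => anyLE (fun v => force (Nat.add G (Nat.mul v b)) fun G' =>
          force (Nat.sub rem v) fun rem' => ih rem' G' U') rem) t

/-- Collect the places of the list that are in the mask `W`. -/
def places (W : ℕ) (k : List ℕ → Bool) : List ℕ → List ℕ → Bool :=
  List.rec (fun acc => k acc) fun b _ ih acc =>
    cond (Nat.beq (Nat.land W b) 0) (ih acc) (ih (b :: acc))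

/-- Try all candidates as the one that has length `l`. -/
def branch (bs : List ℕ) (l G U : ℕ) (k : ℕ → ℕ → Bool) : List Cand → Bool :=
  List.rec false fun c _ ih =>
    cond (force (Nat.add c.s (Nat.mod (Nat.land G c.M) 255)) fun base =>
        cond (Nat.ble base l)
          (force (Nat.sub l base) fun rem =>
            places (Nat.land U c.M) (fun idx => assign k idx rem G U) bs [])
          false)
      true ih

/-- Find a length from `l` on that is not in `det`. -/
def target (det : ℕ) (k : ℕ → Bool) : ℕ → ℕ → Bool :=
  Nat.rec (fun _ => true) fun _ ih l =>
    cond (Nat.beq (Nat.land det (Nat.shiftLeft 1 l)) 0) (k l) (force (Nat.succ l) ih)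

/-- All digits of `W` at the places of the list are at most `cap`. -/
def bounded (W cap : ℕ) : List ℕ → Bool :=
  List.rec true fun b _ ih => cond (Nat.ble (Nat.land W (Nat.mul 255 b)) (Nat.mul cap b)) ih false

/-- The search: `G` packs the known gaps, diminished by the lower bounds packed in `LB`, and `U` is
the mask of the unknown ones. The `N` gaps have sum `n`, and `tot` after subtraction of the lower
bounds; the last gap, at the place `top`, is the largest one. The value `false` means that the
lengths from `3` to `n - 1` cannot all be attained. -/
def node (bs : List ℕ) (N top LB n tot : ℕ) : ℕ → ℕ → ℕ → ℕ → ℕ → ℕ → List Cand → Bool :=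
  -- Running out of fuel gives `true`, which refutes nothing, so soundness does not depend on the
  -- amount of fuel.
  Nat.rec (fun _ _ _ _ _ _ => true) fun _ ih l G U det slack live =>
    force (Nat.mod G 255) fun sum =>
      cond (Nat.ble sum tot)
        (force (Nat.sub tot sum) fun rest => force (Nat.add G LB) fun W =>
          -- An upper bound for the last gap, hence for every gap: its own value, read off as the
          -- top digit, if it is known, and otherwise all that is left plus its lower bound 1.
          force (cond (Nat.beq (Nat.land U top) 0) (Nat.div W top) (Nat.succ rest)) fun cap =>
          cond (Nat.ble n (Nat.mul N cap))
            (cond (bounded W cap bs)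
              (scan G U rest (fun det slack acc =>
                List.rec true (fun _ _ _ =>
                  target det (fun l => cond (Nat.ble 3 l) (cond (Nat.ble n l) true
                    (branch bs l G U (fun G' U' => ih l G' U' det slack acc) acc)) true) n l) acc)
                live det slack [])
              false)
            false)
        false

theorem node_succ (bs : List ℕ) (N top LB n tot fuel l G U det slack : ℕ) (live : List Cand) :
    node bs N top LB n tot (fuel + 1) l G U det slack live =
      force (Nat.mod G 255) fun sum =>
        cond (Nat.ble sum tot)
          (force (Nat.sub tot sum) fun rest => force (Nat.add G LB) fun W =>
            force (cond (Nat.beq (Nat.land U top) 0) (Nat.div W top) (Nat.succ rest)) fun cap =>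
            cond (Nat.ble n (Nat.mul N cap))
              (cond (bounded W cap bs)
                (scan G U rest (fun det slack acc =>
                  List.rec true (fun _ _ _ =>
                    target det (fun l => cond (Nat.ble 3 l) (cond (Nat.ble n l) true
                      (branch bs l G U (fun G' U' => node bs N top LB n tot fuel l G' U' det slack
                        acc) acc)) true) n l) acc)
                  live det slack [])
                false)
              false)
          false := rfl

/-! ### Soundness of the search -/

section Sound

variable {N n : ℕ} {h : ℕ → ℕ}

/-- The candidate `c` is a cycle of length `l` for the gaps `h`. -/
def Fits (N : ℕ) (h : ℕ → ℕ) (c : Cand) (l : ℕ) : Prop :=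
  ∃ β : ℕ → Bool, c.M = mask β N ∧ c.s + wt h β N = l ∧
    ∀ z ∈ c.zs, ∃ r < N, z = mask (fun i => Nat.beq i r) N ∧ h r ≠ 0

/-- The mask determines which gaps are selected, so a candidate has at most one length. -/
theorem Fits.unique {c : Cand} {l l' : ℕ} (h₁ : Fits N h c l) (h₂ : Fits N h c l') : l = l' := by
  obtain ⟨β, hM, hl, -⟩ := h₁
  obtain ⟨β', hM', hl', -⟩ := h₂
  rw [← hl, ← hl', wt_congr (mask_inj (hM.symm.trans hM'))]

/-- The lengths that are not recorded yet. -/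
def missing (n det : ℕ) : Finset ℕ := (Ico 3 n).filter fun l => det.testBit l = false

/-- The state of the search is consistent with the gaps `h`. -/
def Inv (N n : ℕ) (h : ℕ → ℕ) (det slack : ℕ) (L : List Cand) : Prop :=
  (∀ l ∈ missing n det, ∃ c ∈ L, Fits N h c l) ∧ L.length ≤ (missing n det).card + slack

theorem Inv.perm {det slack : ℕ} {L L' : List Cand} (hI : Inv N n h det slack L)
    (hp : L.Perm L') : Inv N n h det slack L' := by
  refine ⟨fun l hl => ?_, hp.length_eq ▸ hI.2⟩
  obtain ⟨c, hc, hf⟩ := hI.1 l hl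
  exact ⟨c, hp.mem_iff.1 hc, hf⟩

/-- Different lengths need different candidates, by `Fits.unique`. -/
theorem card_missing_le {det : ℕ} {L : List Cand}
    (hI : ∀ l ∈ missing n det, ∃ c ∈ L, Fits N h c l) : (missing n det).card ≤ L.length := by
  classical
  choose! f hf hfit using hI
  have hinj : Set.InjOn f (missing n det) := fun a ha b hb hab =>
    (hfit a ha).unique (hab ▸ hfit b hb)
  calc (missing n det).card = ((missing n det).image f).card := (card_image_of_injOn hinj).symm
    _ ≤ L.length := by
      refine (card_le_card fun c hc => ?_).trans L.toFinset_card_le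
      obtain ⟨l, hl, rfl⟩ := mem_image.1 hc
      exact List.mem_toFinset.2 (hf l hl)

/-- A candidate that supplies no missing length is superfluous: the others still cover all of them,
so there was at least one candidate too many and the slack was positive. -/
theorem Inv.drop {det slack : ℕ} {c : Cand} {L : List Cand} (hI : Inv N n h det slack (c :: L))
    (hc : ∀ l ∈ missing n det, ¬ Fits N h c l) : ∃ m, slack = m + 1 ∧ Inv N n h det m L := by
  have h1 : ∀ l ∈ missing n det, ∃ c ∈ L, Fits N h c l := by
    intro l hl
    obtain ⟨d, hd, hf⟩ := hI.1 l hl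
    rcases List.mem_cons.1 hd with rfl | hd
    · exact absurd hf (hc l hl)
    · exact ⟨d, hd, hf⟩
  have h2 := card_missing_le h1
  have h3 := hI.2
  rw [List.length_cons] at h3
  exact ⟨slack - 1, by omega, h1, by omega⟩

theorem testBit_eq_false_iff (det x : ℕ) :
    Nat.beq (Nat.land det (Nat.shiftLeft 1 x)) 0 = true ↔ det.testBit x = false := by
  rw [Nat.beq_eq]
  change det &&& (1 <<< x) = 0 ↔ _
  rw [Nat.one_shiftLeft]
  constructor
  · intro h0
    have := congrArg (fun y => y.testBit x) h0
    simpa using this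
  · intro h0
    refine Nat.eq_of_testBit_eq fun j => ?_
    rw [Nat.testBit_and, Nat.testBit_two_pow]
    by_cases hj : x = j
    · subst hj; simp [h0]
    · simp [hj]

/-- A new length removes one candidate and at most one missing length, so the slack may stay; a
length recorded earlier makes the candidate superfluous. A new length outside the range from 3 to n
- 1 is harmless, as the bound on the number of candidates only improves. -/
theorem Inv.record {det slack x : ℕ} {c : Cand} {L : List Cand}
    (hI : Inv N n h det slack (c :: L)) (hx : ∀ l, Fits N h c l → l = x) {k : ℕ → ℕ → Bool}
    (hk : ∀ d m, Inv N n h d m L → k d m = true) : record k det slack x = true := by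
  unfold Pancyclic.record
  simp only [force_eq]
  cases hb : Nat.beq (Nat.land det (Nat.shiftLeft 1 x)) 0 with
  | true =>
    refine hk _ _ ?_
    have hmem : ∀ l, l ∈ missing n (Nat.lor det (Nat.shiftLeft 1 x)) ↔
        l ∈ missing n det ∧ l ≠ x := by
      intro l
      change l ∈ missing n (det ||| (1 <<< x)) ↔ _
      rw [Nat.one_shiftLeft]
      simp only [missing, mem_filter, Nat.testBit_or, Nat.testBit_two_pow, Bool.or_eq_false_iff,
        decide_eq_false_iff_not]
      constructor
      · rintro ⟨h1, h2, h3⟩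
        exact ⟨⟨h1, h2⟩, fun e => h3 e.symm⟩
      · rintro ⟨⟨h1, h2⟩, h3⟩
        exact ⟨h1, h2, fun e => h3 e.symm⟩
    constructor
    · intro l hl
      obtain ⟨h1, h2⟩ := (hmem l).1 hl
      obtain ⟨d, hd, hf⟩ := hI.1 l h1
      rcases List.mem_cons.1 hd with rfl | hd
      · exact absurd (hx l hf) h2
      · exact ⟨d, hd, hf⟩
    · have h1 : (missing n det).card ≤
          (missing n (Nat.lor det (Nat.shiftLeft 1 x))).card + 1 := by
        refine (card_le_card (fun l hl => ?_)).trans (card_insert_le x _)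
        by_cases e : l = x
        · exact mem_insert.2 (Or.inl e)
        · exact mem_insert.2 (Or.inr ((hmem l).2 ⟨hl, e⟩))
      have h2 := hI.2
      rw [List.length_cons] at h2
      omega
  | false =>
    have hdet : det.testBit x = true := by
      rw [← Bool.not_eq_false, ← testBit_eq_false_iff, hb]
      simp
    obtain ⟨m, rfl, hm⟩ := hI.drop (fun l hl hf => by
      rw [hx l hf] at hl
      simp [missing, hdet] at hl)
    exact hk _ _ hm

theorem blocked_sound (hh : ∑ r ∈ range N, h r < 255) {u : ℕ → Bool} {zs : List ℕ}
    (hb : blocked (sel h (fun r => !u r) N) (mask u N) zs = true) :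
    ¬ ∀ z ∈ zs, ∃ r < N, z = mask (fun i => Nat.beq i r) N ∧ h r ≠ 0 := by
  induction zs with
  | nil => exact absurd hb (by simp [blocked])
  | cons z zs ih =>
    intro hz
    have ih' : blocked (sel h (fun r => !u r) N) (mask u N) zs ≠ true := fun hb' =>
      ih hb' fun z' hz' => hz z' (List.mem_cons_of_mem _ hz')
    change cond (Nat.beq (mask u N &&& z) 0) (cond (Nat.beq (sel h (fun r => !u r) N &&& z) 0) true
      (blocked (sel h (fun r => !u r) N) (mask u N) zs)) (blocked _ _ zs) = true at hb
    cases h1 : Nat.beq (mask u N &&& z) 0 with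
    | false => rw [h1] at hb; exact ih' hb
    | true =>
      cases h2 : Nat.beq (sel h (fun r => !u r) N &&& z) 0 with
      | false => rw [h1, h2] at hb; exact ih' hb
      | true =>
        obtain ⟨r, hr, rfl, h0⟩ := hz z List.mem_cons_self
        rw [Nat.beq_eq, mask_land] at h1
        rw [Nat.beq_eq, sel_land (lt_of_sum_lt hh)] at h2
        have h3 := mask_eq_zero h1 r hr
        have h4 := pack_inj (f := fun r' => cond (!u r' && Nat.beq r' r) (h r') 0)
          (g := fun _ => 0) (fun r' hr' => cond_lt (lt_of_sum_lt hh r' hr')) (by simp)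
          (h2.trans (by simp [pack_eq_sum])) r hr
        simp only [show Nat.beq r r = true from Nat.beq_refl r, Bool.and_true] at h3 h4
        rw [h3] at h4
        exact h0 h4

theorem wt_split (h : ℕ → ℕ) (β u : ℕ → Bool) (N : ℕ) :
    wt h β N = wt h (fun r => !u r && β r) N + wt h (fun r => u r && β r) N := by
  unfold wt
  rw [← sum_add_distrib]
  refine sum_congr rfl fun r _ => ?_
  dsimp only
  cases β r <;> cases u r <;> simp

/-- The invariant concerns the unscanned candidates together with the collected ones; moving an
undetermined candidate from one list to the other only permutes them. -/
theorem scan_sound (hh : ∑ r ∈ range N, h r < 255) (u : ℕ → Bool)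
    {k : ℕ → ℕ → List Cand → Bool}
    (hk : ∀ det slack acc, Inv N n h det slack acc → k det slack acc = true) (L : List Cand) :
    ∀ det slack acc, Inv N n h det slack (L ++ acc) →
      scan (sel h (fun r => !u r) N) (mask u N) (wt h u N) k L det slack acc = true := by
  induction L with
  | nil => exact fun det slack acc hI => hk det slack acc hI
  | cons c L ih =>
    intro det slack acc hI
    rw [List.cons_append] at hI
    set G := sel h (fun r => !u r) N with hG
    have hbase : ∀ β, c.M = mask β N →
        Nat.mod (Nat.land G c.M) 255 = wt h (fun r => !u r && β r) N := by
      intro β hβ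
      rw [hβ, hG]
      change (sel h (fun r => !u r) N &&& mask β N) % 255 = _
      rw [sel_land (lt_of_sum_lt hh), sel_mod hh]
    change cond (blocked G (mask u N) c.zs)
      (spend (fun m => scan G (mask u N) (wt h u N) k L det m acc) slack) _ = true
    cases hb : blocked G (mask u N) c.zs with
    | true =>
      obtain ⟨m, rfl, hm⟩ := hI.drop (fun l _ hf => by
        obtain ⟨β, -, -, hz⟩ := hf
        exact blocked_sound hh hb hz)
      exact ih _ _ _ hm
    | false =>
      rw [cond_false, force_eq]
      cases h0 : Nat.beq (Nat.land c.M (mask u N)) 0 with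
      | true =>
        refine hI.record (fun l hf => ?_) fun d m hm => ih _ _ _ hm
        obtain ⟨β, hβ, hl, -⟩ := hf
        rw [hbase β hβ, ← hl, wt_split h β u N]
        rw [Nat.beq_eq, hβ] at h0
        have h1 := mask_eq_zero ((mask_land β u N).symm.trans h0)
        have h2 : wt h (fun r => u r && β r) N = 0 := by
          refine sum_eq_zero fun r hr => ?_
          have h3 := h1 r (mem_range.1 hr)
          rw [Bool.and_comm] at h3
          simp [h3]
        rw [h2]
        rfl
      | false =>
        rw [cond_false]
        cases h1 : Nat.beq (Nat.land c.M (mask u N)) (mask u N) with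
        | true =>
          refine hI.record (fun l hf => ?_) fun d m hm => ih _ _ _ hm
          obtain ⟨β, hβ, hl, -⟩ := hf
          rw [hbase β hβ, ← hl, wt_split h β u N]
          rw [Nat.beq_eq, hβ] at h1
          have h2 := mask_inj ((mask_land β u N).symm.trans h1)
          have h3 : wt h (fun r => u r && β r) N = wt h u N :=
            wt_congr fun r hr => by rw [Bool.and_comm, h2 r hr]
          rw [h3, ← add_assoc]
          rfl
        | false =>
          exact ih _ _ _ (hI.perm (List.perm_middle.symm))

theorem anyLE_of {f : ℕ → Bool} {m v : ℕ} (hv : v ≤ m) (hf : f v = true) : anyLE f m = true := by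
  induction m with
  | zero =>
    obtain rfl : v = 0 := by omega
    exact hf
  | succ m ih =>
    change cond (f (m + 1)) true (anyLE f m) = true
    by_cases e : v = m + 1
    · rw [← e, hf]; rfl
    · rw [ih (by omega)]
      cases f (m + 1) <;> rfl

/-- An unknown gap has digit zero among the known ones, so adding its value at its place declares it
known without a carry. `mask_sub` is the matching update of the unknown gaps. -/
theorem sel_add {u : ℕ → Bool} {i : ℕ} (hi : i < N) (hu : u i = true) :
    sel h (fun r => !u r) N + h i * 256 ^ i = sel h (fun r => !(u r && !Nat.beq r i)) N := by
  simp only [sel, pack_eq_sum]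
  have hm := mem_range.2 hi
  rw [← add_sum_erase _ _ hm, ← add_sum_erase (range N) _ hm]
  have : ∑ x ∈ (range N).erase i, (cond (!u x) (h x) 0) * 256 ^ x =
      ∑ x ∈ (range N).erase i, (cond (!(u x && !Nat.beq x i)) (h x) 0) * 256 ^ x := by
    refine sum_congr rfl fun x hx => ?_
    have : Nat.beq x i = false := by
      rw [← Bool.not_eq_true, Nat.beq_eq]; exact ne_of_mem_erase hx
    simp [this]
  rw [this, hu, show Nat.beq i i = true from Nat.beq_refl i]
  simp [add_comm]

theorem mask_sub {u : ℕ → Bool} {i : ℕ} (hi : i < N) (hu : u i = true) :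
    mask u N - 255 * 256 ^ i = mask (fun r => u r && !Nat.beq r i) N := by
  simp only [mask, pack_eq_sum]
  have hm := mem_range.2 hi
  rw [← add_sum_erase _ _ hm, ← add_sum_erase (range N) _ hm]
  have : ∑ x ∈ (range N).erase i, (cond (u x) 255 0) * 256 ^ x =
      ∑ x ∈ (range N).erase i, (cond (u x && !Nat.beq x i) 255 0) * 256 ^ x := by
    refine sum_congr rfl fun x hx => ?_
    have : Nat.beq x i = false := by
      rw [← Bool.not_eq_true, Nat.beq_eq]; exact ne_of_mem_erase hx
    simp [this]
  rw [this, hu, show Nat.beq i i = true from Nat.beq_refl i]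
  simp

theorem assign_sound {k : ℕ → ℕ → Bool}
    (hk : ∀ u : ℕ → Bool, k (sel h (fun r => !u r) N) (mask u N) = true) (is : List ℕ) :
    ∀ (u : ℕ → Bool) (rem : ℕ), is.Nodup → (∀ i ∈ is, i < N ∧ u i = true) →
      (is.map h).sum = rem →
      assign k (is.map fun i => 256 ^ i) rem (sel h (fun r => !u r) N) (mask u N) = true := by
  induction is with
  | nil => exact fun u _ _ _ _ => hk u
  | cons i is ih =>
    intro u rem hnd hu hsum
    rw [List.nodup_cons] at hnd
    obtain ⟨hi, hui⟩ := hu i List.mem_cons_self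
    rw [List.map_cons, List.sum_cons] at hsum
    cases is with
    | nil =>
      change force (mask u N - 255 * 256 ^ i) (fun U' =>
        force (sel h (fun r => !u r) N + rem * 256 ^ i) fun G' => k G' U') = true
      rw [force_eq, force_eq, show rem = h i by simpa using hsum.symm, sel_add hi hui,
        mask_sub hi hui]
      exact hk _
    | cons j js =>
      change force (mask u N - 255 * 256 ^ i) (fun U' =>
        anyLE (fun v => force (sel h (fun r => !u r) N + v * 256 ^ i) fun G' =>
          force (rem - v) fun rem' =>
            assign k ((j :: js).map fun i => 256 ^ i) rem' G' U') rem) = true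
      rw [force_eq]
      -- Among the values tried is the true one, and the search is followed there.
      refine anyLE_of (v := h i) (by omega) ?_
      rw [force_eq, force_eq, sel_add hi hui, mask_sub hi hui]
      refine ih _ _ hnd.2 (fun x hx => ?_) (by omega)
      obtain ⟨h1, h2⟩ := hu x (List.mem_cons_of_mem _ hx)
      refine ⟨h1, ?_⟩
      have : Nat.beq x i = false := by
        rw [← Bool.not_eq_true, Nat.beq_eq]
        rintro rfl
        exact hnd.1 hx
      simp [h2, this]

theorem places_eq (W : ℕ) (k : List ℕ → Bool) (L : List ℕ) : ∀ acc,
    places W k L acc = k ((L.filter fun b => !Nat.beq (Nat.land W b) 0).reverse ++ acc) := by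
  induction L with
  | nil => exact fun acc => rfl
  | cons b L ih =>
    intro acc
    change cond (Nat.beq (Nat.land W b) 0) (places W k L acc) (places W k L (b :: acc)) = _
    rw [ih, ih, List.filter_cons]
    cases Nat.beq (Nat.land W b) 0 <;> simp

/-- The number 256 ^ i is the lowest bit of the digit at place i, and that bit is set in 255 but not
in 0. -/
theorem mask_land_pow (γ : ℕ → Bool) {i : ℕ} (hi : i < N) :
    Nat.beq (Nat.land (mask γ N) (256 ^ i)) 0 = !γ i := by
  have h1 : 256 ^ i = pack (fun r => cond (Nat.beq r i) 1 0) N := by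
    rw [pack_eq_sum, sum_eq_single i]
    · simp
    · intro r _ hr
      have : Nat.beq r i = false := by rw [← Bool.not_eq_true, Nat.beq_eq]; exact hr
      simp [this]
    · intro h
      exact absurd (mem_range.2 hi) h
  have h2 : Nat.land (mask γ N) (256 ^ i) = cond (γ i) (256 ^ i) 0 := by
    change mask γ N &&& 256 ^ i = _
    rw [h1, mask, pack_land (fun r _ => cond_lt (by norm_num)) (fun r _ => cond_lt (by norm_num)),
      ← h1, pack_eq_sum, sum_eq_single i]
    · simp only [show Nat.beq i i = true from Nat.beq_refl i]
      cases γ i <;> simp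
    · intro r _ hr
      have : Nat.beq r i = false := by rw [← Bool.not_eq_true, Nat.beq_eq]; exact hr
      simp [this]
    · intro h
      exact absurd (mem_range.2 hi) h
  rw [h2]
  cases γ i
  · rfl
  · rw [cond_true, Bool.not_true, ← Bool.not_eq_true, Nat.beq_eq]
    positivity

/-- For the candidate that really has length l, the unknown gaps in it sum to l minus the known
part, so `assign` meets their true values. The continuation need only succeed on states consistent
with h, whichever gaps these declare unknown. -/
theorem branch_sound (hh : ∑ r ∈ range N, h r < 255) {k : ℕ → ℕ → Bool}
    (hk : ∀ u : ℕ → Bool, k (sel h (fun r => !u r) N) (mask u N) = true) (u : ℕ → Bool) {l : ℕ}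
    {L : List Cand} (hL : ∃ c ∈ L, Fits N h c l) :
    branch ((List.range N).map fun i => 256 ^ i) l (sel h (fun r => !u r) N) (mask u N) k L =
      true := by
  induction L with
  | nil => simp at hL
  | cons c L ih =>
    change cond (force (Nat.add c.s (Nat.mod (Nat.land (sel h (fun r => !u r) N) c.M) 255)) fun base =>
        cond (Nat.ble base l)
          (force (Nat.sub l base) fun rem =>
            places (Nat.land (mask u N) c.M) (fun idx => assign k idx rem _ (mask u N)) _ [])
          false) true (branch _ l _ (mask u N) k L) = true
    obtain ⟨d, hd, β, hβ, hl, hz⟩ := hL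
    rcases List.mem_cons.1 hd with rfl | hd
    · have hbase : Nat.mod (Nat.land (sel h (fun r => !u r) N) d.M) 255 =
          wt h (fun r => !u r && β r) N := by
        rw [hβ]
        change (sel h (fun r => !u r) N &&& mask β N) % 255 = _
        rw [sel_land (lt_of_sum_lt hh), sel_mod hh]
      rw [wt_split h β u N] at hl
      have hU : Nat.land (mask u N) d.M = mask (fun r => u r && β r) N := by
        rw [hβ]; exact mask_land _ _ _
      rw [force_eq, hbase, force_eq, places_eq, hU]
      have hle : Nat.ble (Nat.add d.s (wt h (fun r => !u r && β r) N)) l = true :=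
        Nat.ble_eq.mpr (show d.s + _ ≤ l by omega)
      rw [hle, cond_true, List.append_nil, List.filter_map, ← List.map_reverse]
      have hfil : (List.range N).filter ((fun b => !Nat.beq
          (Nat.land (mask (fun r => u r && β r) N) b) 0) ∘ fun i => 256 ^ i) =
          (List.range N).filter fun i => u i && β i := by
        refine List.filter_congr fun i hi => ?_
        rw [Function.comp, mask_land_pow _ (List.mem_range.1 hi), Bool.not_not]
      rw [hfil, assign_sound hk]
      · rfl
      · exact List.nodup_reverse.2 (List.nodup_range.filter _)
      · intro i hi
        rw [List.mem_reverse, List.mem_filter, List.mem_range, Bool.and_eq_true] at hi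
        exact ⟨hi.1, hi.2.1⟩
      · rw [List.map_reverse, List.sum_reverse]
        have : (((List.range N).filter fun i => u i && β i).map h).sum =
            wt h (fun r => u r && β r) N := by
          unfold wt
          rw [Finset.sum_range, ← List.sum_ofFn]
          clear * -
          induction N with
          | zero => rfl
          | succ N ih =>
            rw [List.range_succ, List.filter_append, List.map_append, List.sum_append, ih,
              List.ofFn_succ', List.concat_eq_append, List.sum_append]
            congr 1
            simp only [Fin.val_last, List.filter_cons, List.filter_nil]
            cases (u N && β N) <;> simp
        rw [this]
        change _ = l - (d.s + _)
        omega
    · rw [ih ⟨d, hd, β, hβ, hl, hz⟩]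
      cases force _ _ <;> rfl

theorem target_sound {det : ℕ} {k : ℕ → Bool} (hk : ∀ l, det.testBit l = false → k l = true)
    (fuel : ℕ) : ∀ l, target det k fuel l = true := by
  induction fuel with
  | zero => exact fun _ => rfl
  | succ fuel ih =>
    intro l
    change cond (Nat.beq (Nat.land det (Nat.shiftLeft 1 l)) 0) (k l)
      (force (Nat.succ l) (target det k fuel)) = true
    cases hb : Nat.beq (Nat.land det (Nat.shiftLeft 1 l)) 0 with
    | true => exact hk l ((testBit_eq_false_iff det l).1 hb)
    | false => rw [cond_false, force_eq]; exact ih _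

theorem pack_land_single {f : ℕ → ℕ} (hf : ∀ r < N, f r < 256) {i : ℕ} (hi : i < N) :
    pack f N &&& (255 * 256 ^ i) = f i * 256 ^ i := by
  rw [← mask_single hi]
  have e : pack f N = sel f (fun _ => true) N := rfl
  rw [e, sel_land hf, sel, pack_eq_sum, sum_eq_single i]
  · simp
  · intro r _ hr
    have : Nat.beq r i = false := by rw [← Bool.not_eq_true, Nat.beq_eq]; exact hr
    simp [this]
  · intro h
    exact absurd (mem_range.2 hi) h

theorem bounded_of {f : ℕ → ℕ} (hf : ∀ r < N, f r < 256) {cap : ℕ} (hcap : ∀ r < N, f r ≤ cap)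
    {is : List ℕ} (his : ∀ i ∈ is, i < N) :
    bounded (pack f N) cap (is.map fun i => 256 ^ i) = true := by
  induction is with
  | nil => rfl
  | cons i is ih =>
    have hi := his i List.mem_cons_self
    change cond (Nat.ble (pack f N &&& (255 * 256 ^ i)) (cap * 256 ^ i))
      (bounded (pack f N) cap (is.map fun i => 256 ^ i)) false = true
    rw [ih fun j hj => his j (List.mem_cons_of_mem _ hj), pack_land_single hf hi]
    have : Nat.ble (f i * 256 ^ i) (cap * 256 ^ i) = true :=
      Nat.ble_eq.mpr (Nat.mul_le_mul_right _ (hcap i hi))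
    rw [this]
    rfl

/-- Following the true gaps h through the tree, every pruning test passes and the smallest missing
length is attained by a live candidate, so one branch always survives. The values h are the excesses
over the lower bounds given by lb. -/
theorem node_sound {lb : ℕ → Bool} (hN : 0 < N)
    (hsum : ∑ r ∈ range N, (h r + cond (lb r) 1 0) = n) (hn : n < 255) (hlb : lb (N - 1) = true)
    (hmax : ∀ r < N, h r + cond (lb r) 1 0 ≤ h (N - 1) + 1) (fuel : ℕ) :
    ∀ l (u : ℕ → Bool) det slack live, Inv N n h det slack live →
      node ((List.range N).map fun i => 256 ^ i) N (256 ^ (N - 1))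
        (pack (fun r => cond (lb r) 1 0) N) n (∑ r ∈ range N, h r) fuel l
        (sel h (fun r => !u r) N) (mask u N) det slack live = true := by
  have hh : ∑ r ∈ range N, h r < 255 :=
    lt_of_le_of_lt (sum_le_sum fun r _ => Nat.le_add_right _ _) (hsum ▸ hn)
  induction fuel with
  | zero => exact fun _ _ _ _ _ _ => rfl
  | succ fuel ih =>
    intro l u det slack live hI
    have hsplit : ∑ r ∈ range N, h r = wt h (fun r => !u r) N + wt h u N := by
      unfold wt
      rw [← sum_add_distrib]
      refine sum_congr rfl fun r _ => ?_
      dsimp only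
      cases u r <;> simp
    have hmod : Nat.mod (sel h (fun r => !u r) N) 255 = wt h (fun r => !u r) N := sel_mod hh _
    rw [node_succ, hmod, force_eq]
    have hle : Nat.ble (wt h (fun r => !u r) N) (∑ r ∈ range N, h r) = true :=
      Nat.ble_eq.mpr (by omega)
    have hrest : Nat.sub (∑ r ∈ range N, h r) (wt h (fun r => !u r) N) = wt h u N := by
      change (_ : ℕ) - _ = _
      omega
    set w : ℕ → ℕ := fun r => cond (!u r) (h r) 0 + cond (lb r) 1 0 with hw
    have hW : Nat.add (sel h (fun r => !u r) N) (pack (fun r => cond (lb r) 1 0) N) = pack w N := by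
      change sel _ _ N + _ = _
      simp only [sel, pack_eq_sum, ← sum_add_distrib, hw, add_mul]
    have hwle : ∀ r, w r ≤ h r + cond (lb r) 1 0 := fun r => by
      simp only [hw]
      cases u r <;> simp
    have hw256 : ∀ r < N, w r < 256 := fun r hr => by
      have h1 := single_le_sum (f := fun r => h r + cond (lb r) 1 0) (fun i _ => Nat.zero_le _)
        (mem_range.2 hr)
      have h2 := hwle r
      omega
    have hcap : h (N - 1) + 1 ≤ cond (Nat.beq (Nat.land (mask u N) (256 ^ (N - 1))) 0)
        (Nat.div (pack w N) (256 ^ (N - 1))) (Nat.succ (wt h u N)) := by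
      rw [mask_land_pow u (show N - 1 < N by omega)]
      cases hu : u (N - 1) with
      | false =>
        change _ ≤ pack w N / 256 ^ (N - 1)
        obtain ⟨N', rfl⟩ : ∃ N', N = N' + 1 := ⟨N - 1, by omega⟩
        rw [Nat.add_sub_cancel] at hu hlb ⊢
        rw [pack_succ, Nat.add_mul_div_right _ _ (by positivity)]
        rw [show w N' = h N' + 1 by simp [hw, hu, hlb]]
        exact Nat.le_add_left _ _
      | true =>
        have h1 := single_le_sum (f := fun r => cond (u r) (h r) 0) (fun i _ => Nat.zero_le _)
          (mem_range.2 (show N - 1 < N by omega))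
        simp only [hu, cond_true] at h1
        exact Nat.succ_le_succ h1
    simp only [hle, cond_true, hrest, force_eq, hW]
    set cap := cond (Nat.beq (Nat.land (mask u N) (256 ^ (N - 1))) 0)
        (Nat.div (pack w N) (256 ^ (N - 1))) (Nat.succ (wt h u N))
    have hncap : Nat.ble n (Nat.mul N cap) = true := by
      refine Nat.ble_eq.mpr ?_
      rw [← hsum]
      refine (sum_le_card_nsmul _ _ cap fun r hr => ?_).trans (by simp)
      exact (hmax r (mem_range.1 hr)).trans hcap
    rw [hncap, cond_true, bounded_of hw256
      (fun r hr => ((hwle r).trans (hmax r hr)).trans hcap) (fun i hi => List.mem_range.1 hi),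
      cond_true]
    refine scan_sound (n := n) hh u (fun det slack acc hI => ?_) live det slack [] (by simpa using hI)
    cases acc with
    | nil => rfl
    | cons c acc =>
      refine target_sound (fun l hl => ?_) _ _
      cases h3 : Nat.ble 3 l with
      | false => rfl
      | true =>
        cases hn : Nat.ble n l with
        | true => rfl
        | false =>
          refine branch_sound hh (fun u' => ih l u' det slack _ hI) u (hI.1 l ?_)
          have h4 : ¬ n ≤ l := by
            rw [← Nat.ble_eq, hn]; simp
          simp only [missing, mem_filter, mem_Ico]
          exact ⟨⟨Nat.ble_eq.mp h3, by omega⟩, hl⟩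

end Sound


/-! ### Candidates of a chord diagram -/

/-- The parity of the number of chords whose interval contains the gap `r`. -/
def par : List (ℕ × ℕ) → ℕ → Bool :=
  List.rec (fun _ => false) fun c _ ih r => xor (Nat.ble c.1 r && Nat.blt r c.2) (ih r)

/-- The mask of `par S`. -/
def chordMask : List (ℕ × ℕ) → ℕ :=
  List.rec 0 fun c _ ih => Nat.xor (Nat.sub (Nat.pow 256 c.2) (Nat.pow 256 c.1)) ih

/-- `r` is an end of a chord in the list. -/
def ends (r : ℕ) : List (ℕ × ℕ) → Bool :=
  List.rec false fun c _ ih => cond (Nat.beq c.1 r) true (cond (Nat.beq c.2 r) true ih)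

/-- All sublists. -/
def subs {α : Type} : List α → List (List α) :=
  List.rec [[]] fun c _ ih => ih ++ ih.map (c :: ·)

/-- The mask `x` is contained in the mask `M`. -/
def within (x M : ℕ) : Bool := Nat.beq (Nat.land x M) x

/-- Some list of fewer than `len` chords gives a mask that is contained in `M`. -/
def splits (full M len : ℕ) : List (List (ℕ × ℕ)) → Bool :=
  List.rec false fun T _ ih =>
    cond (Nat.ble 1 T.length && Nat.blt T.length len)
      (force (chordMask T) fun x =>
        cond (within x M) true (cond (within (Nat.xor full x) M) true ih))
      ih

/-- The gaps that have to be nonzero for the candidate with chords `S` and mask `M`. -/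
def nonzeros (LB M : ℕ) (S : List (ℕ × ℕ)) (k : List ℕ → Bool) : List ℕ → List ℕ → Bool :=
  List.rec (fun acc => k acc) fun r _ ih acc =>
    force (Nat.mul 255 (Nat.pow 256 r)) fun z =>
      cond (Nat.beq (Nat.land LB z) 0 && Nat.beq (Nat.land M z) 0 && ends r S && ends (Nat.succ r) S)
        (ih (z :: acc)) (ih acc)

/-- Add the candidate with chords `S` and mask `M`. -/
def addCand (full LB : ℕ) (rs : List ℕ) (S : List (ℕ × ℕ)) (M : ℕ) (acc : List Cand)
    (k : List Cand → Bool) : Bool :=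
  cond (splits full M S.length (subs S)) (k acc)
    -- The search works with the excess of each gap over its lower bound, so the lower bounds of the
    -- selected gaps join the number of chords in the constant part.
    (force (Nat.add S.length (Nat.mod (Nat.land LB M) 255)) fun s =>
      nonzeros LB M S (fun zs => k (⟨s, M, zs⟩ :: acc)) rs [])

/-- Collect the candidates for all sets of chords in the list. -/
def collect (full LB : ℕ) (rs : List ℕ) (k : List Cand → Bool) :
    List (List (ℕ × ℕ)) → List Cand → Bool :=
  List.rec (fun acc => k acc) fun S _ ih acc =>
    cond (Nat.beq S.length 0) (ih acc)
      (force (chordMask S) fun M => addCand full LB rs S M acc fun acc =>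
        force (Nat.xor full M) fun M' => addCand full LB rs S M' acc ih)

/-- The gap `r` is positive for every configuration with chord diagram `l`: it is the last one, or
its ends belong to crossing chords. -/
def positive (N : ℕ) (l : List (ℕ × ℕ)) (r : ℕ) : Bool :=
  Nat.beq (r + 1) N || l.any fun c => l.any fun d =>
    Nat.blt c.1 d.1 && Nat.blt d.1 c.2 && Nat.blt c.2 d.2 &&
      (Nat.beq c.1 r && Nat.beq d.1 (r + 1) || Nat.beq d.1 r && Nat.beq c.2 (r + 1) ||
        Nat.beq c.2 r && Nat.beq d.2 (r + 1))

/-- The chord diagram `l` with `N` ends may give a graph with cycles of all lengths from `3` to `n`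
for some `n` in `ns`. -/
def feasible (N : ℕ) (bs rs ns : List ℕ) (l : List (ℕ × ℕ)) : Bool :=
  force (Nat.sub (Nat.pow 256 N) 1) fun full =>
    force (pack (fun r => cond (positive N l r) 1 0) N) fun LB =>
      collect full LB rs (fun cs => ns.any fun n =>
        cond (Nat.ble (Nat.sub n 3) cs.length)
          (force (Nat.sub n (Nat.mod LB 255)) fun tot =>
            force (Nat.lor 7 (Nat.shiftLeft 63 n)) fun det =>
              force (Nat.sub cs.length (Nat.sub n 3)) fun slack =>
                node bs N (Nat.pow 256 (Nat.pred N)) LB n tot (Nat.add N 2) 3 0 full det slack cs)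
          false) (subs l) []

theorem sublist_of_mem_subs {α : Type} {l T : List α} (hT : T ∈ subs l) : T.Sublist l := by
  induction l generalizing T with
  | nil =>
    rw [show T = [] by simpa [subs] using hT]
  | cons c l ih =>
    change T ∈ subs l ++ (subs l).map (c :: ·) at hT
    rcases List.mem_append.1 hT with hT | hT
    · exact (ih hT).cons c
    · obtain ⟨T', hT', rfl⟩ := List.mem_map.1 hT
      exact (ih hT').cons_cons c

theorem mem_subs_of_sublist {α : Type} {l T : List α} (hT : T.Sublist l) : T ∈ subs l := by
  induction hT with
  | slnil => exact List.mem_singleton.2 rfl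
  | cons c _ ih => exact List.mem_append_left _ ih
  | cons_cons c _ ih => exact List.mem_append_right _ (List.mem_map_of_mem ih)

theorem chordMask_eq {N : ℕ} {S : List (ℕ × ℕ)} (hS : ∀ c ∈ S, c.1 < c.2 ∧ c.2 < N) :
    chordMask S = mask (par S) N := by
  induction S with
  | nil => exact (mask_false N).symm
  | cons c S ih =>
    have hc := hS c List.mem_cons_self
    change (256 ^ c.2 - 256 ^ c.1) ^^^ chordMask S = _
    rw [ih fun d hd => hS d (List.mem_cons_of_mem _ hd), ← mask_Ico hc.1.le hc.2.le, mask_xor]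
    rfl

theorem full_eq (N : ℕ) : Nat.sub (Nat.pow 256 N) 1 = mask (fun _ => true) N := by
  have := mask_Ico (N := N) (Nat.zero_le N) le_rfl
  rw [pow_zero] at this
  refine this.symm.trans (mask_congr fun r hr => ?_)
  have h1 : Nat.ble 0 r = true := Nat.ble_eq.mpr (Nat.zero_le _)
  have h2 : Nat.blt r N = true := Nat.blt_eq.mpr hr
  rw [h1, h2]
  rfl

theorem within_eq (β γ : ℕ → Bool) (N : ℕ) (h : within (mask β N) (mask γ N) = true) :
    ∀ r < N, β r = true → γ r = true := by
  intro r hr hβ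
  rw [within, Nat.beq_eq] at h
  have := mask_inj ((mask_land β γ N).symm.trans h) r hr
  simpa [hβ] using this

theorem ends_iff {r : ℕ} {S : List (ℕ × ℕ)} : ends r S = true ↔ ∃ c ∈ S, c.1 = r ∨ c.2 = r := by
  induction S with
  | nil => simp [ends]
  | cons c S ih =>
    change cond (Nat.beq c.1 r) true (cond (Nat.beq c.2 r) true (ends r S)) = true ↔ _
    rw [List.exists_mem_cons_iff, ← ih, ← Nat.beq_eq, ← Nat.beq_eq]
    cases Nat.beq c.1 r <;> cases Nat.beq c.2 r <;> simp

/-- The set of chords `S`, with the choice `b` on the last gap, describes a cycle of length `len`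
for the gaps `g`. -/
structure Realizes (N : ℕ) (g : ℕ → ℕ) (S : List (ℕ × ℕ)) (b : Bool) (len : ℕ) : Prop where
  length_eq : S.length + wt g (fun r => xor b (par S r)) N = len
  minimal : ∀ T : List (ℕ × ℕ), T.Sublist S → T ≠ [] → T.length < S.length → ∀ b' : Bool,
    ∃ r < N, xor b' (par T r) = true ∧ xor b (par S r) = false
  nonzero : ∀ r, r + 1 < N → xor b (par S r) = false → (∃ c ∈ S, c.1 = r ∨ c.2 = r) →
    (∃ c ∈ S, c.1 = r + 1 ∨ c.2 = r + 1) → g r ≠ 0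

/-! ### Completeness of the list of candidates -/

section

variable {N : ℕ} {g : ℕ → ℕ} {lb : ℕ → Bool}

/-- If a proper nonempty set of the chords gave a mask inside that of S, the edge set would properly
contain another nonempty even edge set, so it would not be a single cycle. A genuine cycle therefore
passes the test. -/
theorem splits_eq_false {S : List (ℕ × ℕ)} {b : Bool} {len : ℕ}
    (hS : ∀ c ∈ S, c.1 < c.2 ∧ c.2 < N) (hR : Realizes N g S b len) (Ts : List (List (ℕ × ℕ)))
    (hTs : ∀ T ∈ Ts, T.Sublist S) :
    splits (mask (fun _ => true) N) (mask (fun r => xor b (par S r)) N) S.length Ts = false := by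
  induction Ts with
  | nil => rfl
  | cons T Ts ih =>
    change cond (Nat.ble 1 T.length && Nat.blt T.length S.length)
      (force (chordMask T) fun x => cond (within x _) true
        (cond (within (Nat.xor _ x) _) true (splits _ _ S.length Ts))) (splits _ _ S.length Ts) =
        false
    rw [ih fun T hT => hTs T (List.mem_cons_of_mem _ hT), force_eq]
    cases hl : (Nat.ble 1 T.length && Nat.blt T.length S.length) with
    | false => rfl
    | true =>
      rw [Bool.and_eq_true, Nat.ble_eq, Nat.blt_eq] at hl
      have hsub := hTs T List.mem_cons_self
      have hne : T ≠ [] := by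
        rintro rfl
        exact absurd hl.1 (by simp)
      have key : ∀ b' : Bool, within (mask (fun r => xor b' (par T r)) N)
          (mask (fun r => xor b (par S r)) N) = false := by
        intro b'
        rw [← Bool.not_eq_true]
        intro hw
        obtain ⟨r, hr, h1, h2⟩ := hR.minimal T hsub hne hl.2 b'
        have := within_eq _ _ N hw r hr h1
        rw [h2] at this
        exact absurd this (by simp)
      have e : Nat.xor (mask (fun _ => true) N) (mask (par T) N) =
          mask (fun r => xor true (par T r)) N := mask_xor _ _ _
      have k0 := key false
      have k1 := key true
      simp only [Bool.false_xor] at k0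
      rw [chordMask_eq fun c hc => hS c (hsub.subset hc), e, k0, k1]
      rfl

/-- The function is in continuation-passing style; the list zs handed to the continuation does not
depend on the continuation. `addCand_spec` and `collect_spec` have the same form. -/
theorem nonzeros_spec {LB M : ℕ} {S : List (ℕ × ℕ)} (rs : List ℕ) : ∀ acc : List ℕ, ∃ zs : List ℕ,
    (∀ k, nonzeros LB M S k rs acc = k zs) ∧ ∀ z ∈ zs, z ∈ acc ∨ ∃ r ∈ rs, z = 255 * 256 ^ r ∧
      LB &&& z = 0 ∧ M &&& z = 0 ∧ ends r S = true ∧ ends (r + 1) S = true := by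
  induction rs with
  | nil => exact fun acc => ⟨acc, fun k => rfl, fun z hz => Or.inl hz⟩
  | cons r rs ih =>
    intro acc
    have hstep : ∀ k, nonzeros LB M S k (r :: rs) acc =
        cond (Nat.beq (Nat.land LB (255 * 256 ^ r)) 0 && Nat.beq (Nat.land M (255 * 256 ^ r)) 0 &&
          ends r S && ends (r + 1) S) (nonzeros LB M S k rs (255 * 256 ^ r :: acc))
          (nonzeros LB M S k rs acc) := by
      intro k
      change force (255 * 256 ^ r) (fun z => cond (Nat.beq (Nat.land LB z) 0 &&
        Nat.beq (Nat.land M z) 0 && ends r S && ends (Nat.succ r) S)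
        (nonzeros LB M S k rs (z :: acc)) (nonzeros LB M S k rs acc)) = _
      rw [force_eq]
    cases hc : (Nat.beq (Nat.land LB (255 * 256 ^ r)) 0 && Nat.beq (Nat.land M (255 * 256 ^ r)) 0 &&
        ends r S && ends (r + 1) S) with
    | false =>
      obtain ⟨zs, h1, h2⟩ := ih acc
      refine ⟨zs, fun k => by rw [hstep, hc]; exact h1 k, fun z hz => ?_⟩
      rcases h2 z hz with h3 | ⟨r', hr', h3⟩
      · exact Or.inl h3
      · exact Or.inr ⟨r', List.mem_cons_of_mem _ hr', h3⟩
    | true =>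
      obtain ⟨zs, h1, h2⟩ := ih (255 * 256 ^ r :: acc)
      refine ⟨zs, fun k => by rw [hstep, hc]; exact h1 k, fun z hz => ?_⟩
      simp only [Bool.and_eq_true, Nat.beq_eq] at hc
      rcases h2 z hz with h3 | ⟨r', hr', h3⟩
      · rcases List.mem_cons.1 h3 with rfl | h3
        · exact Or.inr ⟨r, List.mem_cons_self, rfl, hc.1.1.1, hc.1.1.2, hc.1.2, hc.2⟩
        · exact Or.inl h3
      · exact Or.inr ⟨r', List.mem_cons_of_mem _ hr', h3⟩

theorem sum_lt_of_le_one {lb : ℕ → Bool} (hN : N < 255) :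
    ∑ r ∈ range N, (fun r => cond (lb r) 1 0) r < 255 := by
  refine lt_of_le_of_lt (sum_le_card_nsmul _ _ 1 fun r _ => ?_) (by simpa using hN)
  dsimp only
  cases lb r <;> simp

theorem addCand_spec (hN : N < 255) (hlb : ∀ r < N, lb r = true → 1 ≤ g r)
    {S : List (ℕ × ℕ)} (hS : ∀ c ∈ S, c.1 < c.2 ∧ c.2 < N) (b : Bool) (acc : List Cand) :
    ∃ acc', (∀ k, addCand (mask (fun _ => true) N) (pack (fun r => cond (lb r) 1 0) N)
        (List.range (N - 1)) S (mask (fun r => xor b (par S r)) N) acc k = k acc') ∧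
      acc ⊆ acc' ∧ ∀ len, Realizes N g S b len →
        ∃ c ∈ acc', Fits N (fun r => g r - cond (lb r) 1 0) c len := by
  unfold addCand
  cases hs : splits (mask (fun _ => true) N) (mask (fun r => xor b (par S r)) N) S.length
      (subs S) with
  | true =>
    refine ⟨acc, fun k => rfl, fun _ h => h, fun len hR => ?_⟩
    rw [splits_eq_false hS hR _ fun T hT => sublist_of_mem_subs hT] at hs
    exact absurd hs (by simp)
  | false =>
    set β : ℕ → Bool := fun r => xor b (par S r) with hβ
    obtain ⟨zs, h1, h2⟩ := nonzeros_spec (LB := pack (fun r => cond (lb r) 1 0) N)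
      (M := mask β N) (S := S) (List.range (N - 1)) []
    refine ⟨_, fun k => by rw [cond_false, force_eq]; exact h1 _, List.subset_cons_self _ _,
      fun len hR => ⟨_, List.mem_cons_self, β, rfl, ?_, ?_⟩⟩
    · have e1 : pack (fun r => cond (lb r) 1 0) N = sel (fun r => cond (lb r) 1 0)
          (fun _ => true) N := rfl
      have e2 : Nat.mod (Nat.land (pack (fun r => cond (lb r) 1 0) N) (mask β N)) 255 =
          wt (fun r => cond (lb r) 1 0) β N := by
        change (pack (fun r => cond (lb r) 1 0) N &&& mask β N) % 255 = _
        rw [e1, sel_land (lt_of_sum_lt (sum_lt_of_le_one hN)), sel_mod (sum_lt_of_le_one hN)]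
        simp only [Bool.true_and]
      rw [e2, ← hR.length_eq]
      change S.length + _ + _ = _
      rw [add_assoc, ← hβ]
      congr 1
      unfold wt
      rw [← sum_add_distrib]
      refine sum_congr rfl fun r hr => ?_
      have := hlb r (mem_range.1 hr)
      dsimp only
      cases hbr : β r
      · simp
      · cases hl : lb r
        · simp
        · have := this hl
          simp only [cond_true]
          omega
    · intro z hz
      rcases h2 z hz with h3 | ⟨r, hr, rfl, h4, h5, h6, h7⟩
      · exact absurd h3 (by simp)
      · rw [List.mem_range] at hr
        have hrN : r < N := by omega
        rw [← mask_single hrN] at h4 h5 ⊢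
        refine ⟨r, hrN, rfl, ?_⟩
        have hb : Nat.beq r r = true := Nat.beq_refl r
        have e3 : lb r = false := by
          have e1 : pack (fun r => cond (lb r) 1 0) N = sel (fun r => cond (lb r) 1 0)
            (fun _ => true) N := rfl
          rw [e1, sel_land (lt_of_sum_lt (sum_lt_of_le_one hN))] at h4
          have := pack_inj (g := fun _ => 0)
            (fun r' hr' => cond_lt (lt_of_sum_lt (sum_lt_of_le_one (lb := lb) hN) r' hr'))
            (by simp) (h4.trans (by simp [pack_eq_sum])) r hrN
          simp only [hb, Bool.true_and, cond_true] at this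
          revert this
          cases lb r <;> simp
        have e4 : β r = false := by
          rw [mask_land] at h5
          have := mask_eq_zero h5 r hrN
          simpa [hb] using this
        dsimp only
        rw [e3]
        exact hR.nonzero r (by omega) e4 (ends_iff.1 h6) (ends_iff.1 h7)

theorem collect_spec (hN : N < 255) (hlb : ∀ r < N, lb r = true → 1 ≤ g r)
    (Ss : List (List (ℕ × ℕ))) (hSs : ∀ S ∈ Ss, ∀ c ∈ S, c.1 < c.2 ∧ c.2 < N) :
    ∀ acc : List Cand, ∃ acc', (∀ k, collect (mask (fun _ => true) N)
        (pack (fun r => cond (lb r) 1 0) N) (List.range (N - 1)) k Ss acc = k acc') ∧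
      acc ⊆ acc' ∧ ∀ S ∈ Ss, S ≠ [] → ∀ b len, Realizes N g S b len →
        ∃ c ∈ acc', Fits N (fun r => g r - cond (lb r) 1 0) c len := by
  induction Ss with
  | nil => exact fun acc => ⟨acc, fun k => rfl, fun _ h => h, by simp⟩
  | cons S Ss ih =>
    intro acc
    have ih' := ih fun S' hS' => hSs S' (List.mem_cons_of_mem _ hS')
    have hS := hSs S List.mem_cons_self
    cases hb : Nat.beq S.length 0 with
    | true =>
      obtain ⟨acc', h1, h2, h3⟩ := ih' acc
      refine ⟨acc', fun k => ?_, h2, fun S' hS' hne => ?_⟩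
      · change cond (Nat.beq S.length 0) (collect _ _ _ k Ss acc) _ = _
        rw [hb]
        exact h1 k
      · rcases List.mem_cons.1 hS' with rfl | hS'
        · rw [Nat.beq_eq, List.length_eq_zero_iff] at hb
          exact absurd hb hne
        · exact h3 S' hS' hne
    | false =>
      obtain ⟨acc₁, h1, h1', h1''⟩ := addCand_spec hN hlb hS false acc
      obtain ⟨acc₂, h2, h2', h2''⟩ := addCand_spec hN hlb hS true acc₁
      obtain ⟨acc₃, h3, h3', h3''⟩ := ih' acc₂
      refine ⟨acc₃, fun k => ?_, fun c hc => h3' (h2' (h1' hc)), fun S' hS' hne b len hR => ?_⟩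
      · change cond (Nat.beq S.length 0) _ (force (chordMask S) fun M =>
          addCand _ _ _ S M acc fun acc => force (Nat.xor _ M) fun M' =>
            addCand _ _ _ S M' acc (collect _ _ _ k Ss)) = _
        have e : Nat.xor (mask (fun _ => true) N) (mask (par S) N) =
          mask (fun r => xor true (par S r)) N := mask_xor _ _ _
        simp only [Bool.false_xor] at h1
        rw [hb, cond_false, force_eq, chordMask_eq hS]
        simp only [force_eq, e]
        rw [h1, h2, h3]
      · rcases List.mem_cons.1 hS' with rfl | hS'
        · cases b with
          | false =>
            obtain ⟨c, hc, hf⟩ := h1'' len hR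
            exact ⟨c, h3' (h2' hc), hf⟩
          | true =>
            obtain ⟨c, hc, hf⟩ := h2'' len hR
            exact ⟨c, h3' hc, hf⟩
        · exact h3'' S' hS' hne b len hR

end

theorem missing_init (n : ℕ) : missing n (Nat.lor 7 (Nat.shiftLeft 63 n)) = Ico 3 n := by
  refine filter_true_of_mem fun l hl => ?_
  rw [mem_Ico] at hl
  change (7 ||| 63 <<< n).testBit l = false
  rw [Nat.testBit_or, Nat.testBit_shiftLeft]
  have h1 : (7 : ℕ).testBit l = false :=
    Nat.testBit_eq_false_of_lt (lt_of_lt_of_le (show 7 < 2 ^ 3 by norm_num)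
      (Nat.pow_le_pow_right (by norm_num) hl.1))
  simp [h1, hl.2]

/-- Every length from 3 to n - 1 is realized by some candidate in the collected list. Hence the list
has at least n - 3 members, and the invariant of the search holds initially with all gaps unknown.
-/
theorem feasible_of_realizes {N n : ℕ} {l : List (ℕ × ℕ)} {g : ℕ → ℕ} {ns : List ℕ}
    (hl : ∀ c ∈ l, c.1 < c.2 ∧ c.2 < N) (hn : n ∈ ns) (hN0 : 0 < N) (hN : N < 255) (hn255 : n < 255)
    (hsum : ∑ r ∈ range N, g r = n) (hpos : ∀ r < N, positive N l r = true → 1 ≤ g r)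
    (hmax : ∀ r < N, g r ≤ g (N - 1))
    (hcov : ∀ len, 3 ≤ len → len < n →
      ∃ S : List (ℕ × ℕ), S.Sublist l ∧ S ≠ [] ∧ ∃ b, Realizes N g S b len) :
    feasible N ((List.range N).map fun i => 256 ^ i) (List.range (N - 1)) ns l = true := by
  unfold feasible
  rw [force_eq, force_eq, full_eq]
  obtain ⟨cs, h1, -, h2⟩ := collect_spec (lb := positive N l) hN hpos (subs l)
    (fun S hS c hc => hl c ((sublist_of_mem_subs hS).subset hc)) []
  rw [h1]
  simp only [force_eq]
  refine List.any_eq_true.2 ⟨n, hn, ?_⟩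
  set h : ℕ → ℕ := fun r => g r - cond (positive N l r) 1 0 with hh
  have hfit : ∀ len ∈ missing n (Nat.lor 7 (Nat.shiftLeft 63 n)), ∃ c ∈ cs, Fits N h c len := by
    intro len hlen
    rw [missing_init, mem_Ico] at hlen
    obtain ⟨S, hS, hne, b, hR⟩ := hcov len hlen.1 hlen.2
    exact h2 S (mem_subs_of_sublist hS) hne b len hR
  have hcard := card_missing_le hfit
  rw [missing_init, Nat.card_Ico] at hcard
  have hble : Nat.ble (Nat.sub n 3) cs.length = true := Nat.ble_eq.mpr hcard
  have hhg : ∀ r < N, h r + cond (positive N l r) 1 0 = g r := by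
    intro r hr
    have := hpos r hr
    simp only [hh]
    cases hp : positive N l r
    · simp
    · have := this hp
      simp only [cond_true]
      omega
  have hhn : ∑ r ∈ range N, (h r + cond (positive N l r) 1 0) = n := by
    rw [← hsum]
    exact sum_congr rfl fun r hr => hhg r (mem_range.1 hr)
  have htop : positive N l (N - 1) = true := by
    have : Nat.beq (N - 1 + 1) N = true := by rw [Nat.beq_eq]; omega
    simp [positive, this]
  have hmax' : ∀ r < N, h r + cond (positive N l r) 1 0 ≤ h (N - 1) + 1 := by
    intro r hr
    have h1 := hhg (N - 1) (by omega)
    rw [htop, cond_true] at h1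
    rw [hhg r hr, h1]
    exact hmax r hr
  have htot : Nat.sub n (Nat.mod (pack (fun r => cond (positive N l r) 1 0) N) 255) =
      ∑ r ∈ range N, h r := by
    have e : Nat.mod (pack (fun r => cond (positive N l r) 1 0) N) 255 =
      ∑ r ∈ range N, cond (positive N l r) 1 0 := pack_mod (sum_lt_of_le_one hN)
    rw [e]
    rw [sum_add_distrib] at hhn
    change n - _ = _
    omega
  rw [hble, cond_true, htot]
  have hG : sel h (fun _ => !true) N = 0 := by simp [sel, pack_eq_sum]
  have hInv : Inv N n h (Nat.lor 7 (Nat.shiftLeft 63 n)) (Nat.sub cs.length (Nat.sub n 3)) cs := by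
    refine ⟨hfit, ?_⟩
    rw [missing_init, Nat.card_Ico]
    change _ ≤ n - 3 + (cs.length - (n - 3))
    omega
  have key := node_sound hN0 hhn hn255 htop hmax' (N + 2) 3 (fun _ => true) _ _ cs hInv
  rw [hG] at key
  exact key

/-! ### Perfect matchings -/

/-- All perfect matchings of the list. -/
def matchings : ℕ → List ℕ → List (List (ℕ × ℕ))
  | 0, _ => [[]]
  | _ + 1, [] => [[]]
  | k + 1, x :: xs => xs.flatMap fun y => (matchings k (xs.erase y)).map ((x, y) :: ·)

/-- In an increasing list the first element must be the smaller end of its chord; induction applies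
after both ends of that chord are removed. -/
theorem exists_mem_matchings (k : ℕ) : ∀ (L : List ℕ) (M : Finset (ℕ × ℕ)), L.Pairwise (· < ·) →
    L.length = 2 * k → (∀ c ∈ M, c.1 < c.2 ∧ c.1 ∈ L ∧ c.2 ∈ L) →
    (∀ r ∈ L, ∃ c ∈ M, c.1 = r ∨ c.2 = r) →
    (∀ c ∈ M, ∀ d ∈ M, ∀ r, (c.1 = r ∨ c.2 = r) → (d.1 = r ∨ d.2 = r) → c = d) →
    ∃ l ∈ matchings k L, l.Nodup ∧ l.toFinset = M := by
  induction k with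
  | zero =>
    intro L M _ hlen hM _ _
    obtain rfl : L = [] := List.length_eq_zero_iff.1 (by simpa using hlen)
    refine ⟨[], List.mem_singleton.2 rfl, List.nodup_nil, ?_⟩
    symm
    rw [List.toFinset_nil, eq_empty_iff_forall_notMem]
    intro c hc
    exact absurd (hM c hc).2.1 (by simp)
  | succ k ih =>
    intro L M hL hlen hM hcov huniq
    cases L with
    | nil => simp at hlen
    | cons x xs =>
      rw [List.pairwise_cons] at hL
      obtain ⟨c, hc, hx⟩ := hcov x List.mem_cons_self
      have hcM := hM c hc
      have hc1 : c.1 = x := by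
        rcases hx with hx | hx
        · exact hx
        · rcases List.mem_cons.1 hcM.2.1 with h | h
          · exact h
          · have := hL.1 _ h
            omega
      have hc2 : c.2 ∈ xs := by
        rcases List.mem_cons.1 hcM.2.2 with h | h
        · omega
        · exact h
      have hnd : xs.Nodup := hL.2.imp fun h => ne_of_lt h
      obtain ⟨l, hl, hlnd, hlM⟩ := ih (xs.erase c.2) (M.erase c)
        (hL.2.sublist List.erase_sublist)
        (by rw [List.length_erase_of_mem hc2]; rw [List.length_cons] at hlen; omega)
        (by
          intro d hd
          obtain ⟨hdc, hdM⟩ := mem_erase.1 hd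
          obtain ⟨h1, h2, h3⟩ := hM d hdM
          have hx' : ∀ r, (d.1 = r ∨ d.2 = r) → r ∈ x :: xs → r ∈ xs.erase c.2 := by
            intro r hr hrL
            rw [hnd.mem_erase_iff]
            refine ⟨fun e => hdc (huniq d hdM c hc r hr (Or.inr e.symm)), ?_⟩
            rcases List.mem_cons.1 hrL with h | h
            · exact absurd (huniq d hdM c hc r hr (Or.inl (hc1.trans h.symm))) hdc
            · exact h
          exact ⟨h1, hx' _ (Or.inl rfl) h2, hx' _ (Or.inr rfl) h3⟩)
        (by
          intro r hr
          rw [hnd.mem_erase_iff] at hr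
          obtain ⟨d, hd, hdr⟩ := hcov r (List.mem_cons_of_mem _ hr.2)
          refine ⟨d, mem_erase.2 ⟨?_, hd⟩, hdr⟩
          rintro rfl
          rcases hdr with h | h
          · have := hL.1 r hr.2
            omega
          · exact hr.1 h.symm)
        (fun d hd e he => huniq d (mem_of_mem_erase hd) e (mem_of_mem_erase he))
      refine ⟨c :: l, ?_, ?_, ?_⟩
      · refine List.mem_flatMap.2 ⟨c.2, hc2, List.mem_map.2 ⟨l, hl, ?_⟩⟩
        rw [← hc1]
      · rw [List.nodup_cons]
        refine ⟨fun h => ?_, hlnd⟩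
        rw [← List.mem_toFinset, hlM] at h
        exact notMem_erase c M h
      · rw [List.toFinset_cons, hlM, insert_erase hc]


/-! ### Chords of a Hamiltonian cycle -/

/-- The vertex before `v` on the cycle `0, …, n - 1`. -/
def prev (n v : ℕ) : ℕ := if v = 0 then n - 1 else v - 1

/-- The degree of the vertex `v` in the graph with the chords in `S` and the edges `{x, x + 1}` of the
cycle `0, …, n - 1` for which `X x` holds. -/
def degree (n : ℕ) (S : Finset (ℕ × ℕ)) (X : ℕ → Bool) (v : ℕ) : ℕ :=
  (X v).toNat + (X (prev n v)).toNat + ((S.filter fun c => c.1 = v).card +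
    (S.filter fun c => c.2 = v).card)

/-- `C` is the set of chords of a Hamiltonian cycle `0, …, n - 1` of a graph with cycles of all
lengths, and no stretch of the Hamiltonian cycle without ends of chords is longer than the one
before `0`. -/
structure ChordSystem (n : ℕ) (C : Finset (ℕ × ℕ)) : Prop where
  lt : ∀ c ∈ C, c.1 < c.2 ∧ c.2 < n
  longest : ∀ s d, s + d ≤ n → (∀ y, s < y → y < s + d → ∀ c ∈ C, c.1 ≠ y ∧ c.2 ≠ y) →
    ∀ y, n < y + d → y < n → ∀ c ∈ C, c.1 ≠ y ∧ c.2 ≠ y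
  cover : ∀ len, 3 ≤ len → len < n → ∃ S ⊆ C, S.Nonempty ∧ ∃ X : ℕ → Bool,
    S.card + ((range n).filter fun x => X x = true).card = len ∧
    (∀ v < n, degree n S X v = 0 ∨ degree n S X v = 2) ∧
    ∀ T ⊆ S, T.Nonempty → T ≠ S → ∀ Y : ℕ → Bool, (∀ v < n, Even (degree n T Y v)) →
      ∃ x < n, Y x = true ∧ X x = false

/-- The number of chords in `S` whose interval contains the edge `{x, x + 1}`. -/
def covering (S : Finset (ℕ × ℕ)) (x : ℕ) : ℕ := (S.filter fun c => c.1 ≤ x ∧ x < c.2).card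

/-- Chord by chord: of the edges before and after v + 1, the interval of a chord contains exactly
one if and only if the chord ends at v + 1. -/
theorem even_covering {S : Finset (ℕ × ℕ)} (hS : ∀ c ∈ S, c.1 < c.2) (v : ℕ) :
    Even (covering S (v + 1) + covering S v + ((S.filter fun c => c.1 = v + 1).card +
      (S.filter fun c => c.2 = v + 1).card)) := by
  simp only [covering, card_filter, ← sum_add_distrib]
  refine even_sum _ fun c hc => ?_
  have := hS c hc
  rw [Nat.even_iff]
  split_ifs <;> omega

theorem covering_zero {S : Finset (ℕ × ℕ)} (hS : ∀ c ∈ S, c.1 < c.2) :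
    covering S 0 = (S.filter fun c => c.1 = 0).card + (S.filter fun c => c.2 = 0).card := by
  simp only [covering, card_filter, ← sum_add_distrib]
  refine sum_congr rfl fun c hc => ?_
  have := hS c hc
  split_ifs <;> omega

theorem covering_last {S : Finset (ℕ × ℕ)} {n : ℕ} (hS : ∀ c ∈ S, c.1 < c.2 ∧ c.2 < n) :
    covering S (n - 1) = 0 := by
  rw [covering, card_eq_zero, filter_eq_empty_iff]
  intro c hc
  have := hS c hc
  omega

theorem eq_xor_of_even {a b : Bool} {q : ℕ} (h : Even (a.toNat + b.toNat + q)) :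
    a = xor b (decide (Odd q)) := by
  rw [Nat.even_iff] at h
  have hq : decide (Odd q) = decide (q % 2 = 1) := by rw [decide_eq_decide]; exact Nat.odd_iff
  rw [hq]
  cases a <;> cases b <;> simp at h ⊢ <;> omega

/-- Induction along the cycle, starting from the edge {n - 1, 0}, which no chord interval contains.
At each vertex even degree says that the state of the next edge changes by the parity of the number
of chord ends there. -/
theorem eq_xor_covering {n : ℕ} {S : Finset (ℕ × ℕ)} (hS : ∀ c ∈ S, c.1 < c.2) {X : ℕ → Bool}
    (hX : ∀ v < n, Even (degree n S X v)) (x : ℕ) (hx : x < n) :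
    X x = xor (X (n - 1)) (decide (Odd (covering S x))) := by
  refine eq_xor_of_even ?_
  induction x with
  | zero =>
    have := hX 0 hx
    rw [degree, ← covering_zero hS] at this
    simpa [prev] using this
  | succ v ih =>
    have h1 := hX (v + 1) hx
    have h2 := even_covering hS v
    have h3 := ih (by omega)
    rw [degree, show prev n (v + 1) = v by simp [prev]] at h1
    rw [Nat.even_iff] at *
    omega

/-- The converse of `eq_xor_covering`: either choice for the edge {n - 1, 0} extends to an even edge
set with the given chords. -/
theorem even_degree {n : ℕ} {T : Finset (ℕ × ℕ)} (hT : ∀ c ∈ T, c.1 < c.2 ∧ c.2 < n) (b : Bool)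
    (v : ℕ) : Even (degree n T (fun x => xor b (decide (Odd (covering T x)))) v) := by
  have hT' : ∀ c ∈ T, c.1 < c.2 := fun c hc => (hT c hc).1
  have key : ∀ q, (xor b (decide (Odd q))).toNat % 2 = (b.toNat + q) % 2 := by
    intro q
    have hq : decide (Odd q) = decide (q % 2 = 1) := by rw [decide_eq_decide]; exact Nat.odd_iff
    rw [hq]
    rcases Nat.mod_two_eq_zero_or_one q with h | h <;> cases b <;> simp [h] <;> omega
  unfold degree
  have h1 := key (covering T v)
  have h2 := key (covering T (prev n v))
  rw [Nat.even_iff]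
  cases v with
  | zero =>
    have h3 := covering_zero hT'
    have h4 := covering_last hT
    simp only [prev, if_true] at h2 ⊢
    omega
  | succ v =>
    have h3 := even_covering hT' v
    rw [Nat.even_iff] at h3
    rw [show prev n (v + 1) = v by simp [prev]] at h2 ⊢
    dsimp only
    omega

/-! ### Ranks of the ends of the chords -/

/-- The sort key of the first end of a chord. -/
def firstKey (n : ℕ) (c : ℕ × ℕ) : ℕ := c.1 * (2 * n) + (n + (n - 1 - c.2))

/-- The sort key of the second end of a chord. -/
def secondKey (n : ℕ) (c : ℕ × ℕ) : ℕ := c.2 * (2 * n) + (n - 1 - c.1)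

/-- The sort keys of the ends of the chords. -/
def keys (n : ℕ) (S : Finset (ℕ × ℕ)) : Finset ℕ := S.image (firstKey n) ∪ S.image (secondKey n)

/-- The number of elements of `K` below `t`. -/
def rk (K : Finset ℕ) (t : ℕ) : ℕ := (K.filter (· < t)).card

theorem rk_lt_iff {K : Finset ℕ} {κ t : ℕ} (hκ : κ ∈ K) : rk K κ < rk K t ↔ κ < t := by
  constructor
  · intro h
    by_contra hlt
    have hle : rk K t ≤ rk K κ := card_le_card fun x hx => by
      rw [mem_filter] at hx ⊢
      exact ⟨hx.1, by omega⟩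
    omega
  · intro h
    refine card_lt_card ⟨fun x hx => ?_, fun hsub => ?_⟩
    · rw [mem_filter] at hx ⊢
      exact ⟨hx.1, by omega⟩
    · have := hsub (mem_filter.2 ⟨hκ, h⟩)
      rw [mem_filter] at this
      omega

theorem rk_lt_card {K : Finset ℕ} {κ : ℕ} (hκ : κ ∈ K) : rk K κ < K.card :=
  card_lt_card ⟨filter_subset _ _, fun h => by
    have := h hκ
    rw [mem_filter] at this
    omega⟩

theorem rk_inj {K : Finset ℕ} {κ κ' : ℕ} (hκ : κ ∈ K) (hκ' : κ' ∈ K) (h : rk K κ = rk K κ') :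
    κ = κ' := by
  have h1 := rk_lt_iff (t := κ') hκ
  have h2 := rk_lt_iff (t := κ) hκ'
  omega

theorem exists_rk_eq {K : Finset ℕ} {r : ℕ} (hr : r < K.card) : ∃ κ ∈ K, rk K κ = r := by
  have h1 : K.image (rk K) = range K.card := by
    refine eq_of_subset_of_card_le (fun x hx => ?_) ?_
    · obtain ⟨κ, hκ, rfl⟩ := mem_image.1 hx
      exact mem_range.2 (rk_lt_card hκ)
    · rw [card_range, card_image_of_injOn fun a ha b hb h => rk_inj ha hb h]
  have := mem_range.2 hr
  rw [← h1, mem_image] at this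
  exact this

section Keys

variable {n : ℕ} {C : Finset (ℕ × ℕ)}

theorem key_cases {p t p' t' : ℕ} (ht' : t' < 2 * n)
    (h : p * (2 * n) + t < p' * (2 * n) + t') : p < p' ∨ p = p' ∧ t < t' := by
  rcases lt_trichotomy p p' with h1 | rfl | h1
  · exact Or.inl h1
  · exact Or.inr ⟨rfl, by omega⟩
  · have : (p' + 1) * (2 * n) ≤ p * (2 * n) := Nat.mul_le_mul_right _ (by omega)
    rw [add_mul] at this
    omega

theorem key_inj {p t p' t' : ℕ} (ht : t < 2 * n) (ht' : t' < 2 * n)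
    (h : p * (2 * n) + t = p' * (2 * n) + t') : p = p' ∧ t = t' := by
  have e : ∀ {p t : ℕ}, t < 2 * n → (p * (2 * n) + t) / (2 * n) = p := by
    intro p t ht
    rw [mul_comm, Nat.mul_add_div (by omega), Nat.div_eq_of_lt ht, add_zero]
  have h1 := e (p := p) ht
  rw [h, e ht'] at h1
  subst h1
  exact ⟨rfl, by omega⟩

theorem firstKey_injOn (hC : ∀ c ∈ C, c.1 < c.2 ∧ c.2 < n) : Set.InjOn (firstKey n) C := by
  intro c hc d hd h
  have h1 := hC c hc
  have h2 := hC d hd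
  have := key_inj (by omega) (by omega) h
  exact Prod.ext this.1 (by omega)

theorem secondKey_injOn (hC : ∀ c ∈ C, c.1 < c.2 ∧ c.2 < n) : Set.InjOn (secondKey n) C := by
  intro c hc d hd h
  have h1 := hC c hc
  have h2 := hC d hd
  have := key_inj (by omega) (by omega) h
  exact Prod.ext (by omega) this.1

theorem firstKey_ne_secondKey (hC : ∀ c ∈ C, c.1 < c.2 ∧ c.2 < n) {c d : ℕ × ℕ} (hc : c ∈ C)
    (hd : d ∈ C) : firstKey n c ≠ secondKey n d := by
  intro h
  have h1 := hC c hc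
  have h2 := hC d hd
  have := key_inj (by omega) (by omega) h
  omega

theorem card_filter_keys (hC : ∀ c ∈ C, c.1 < c.2 ∧ c.2 < n) (P : ℕ → Prop) [DecidablePred P] :
    ((keys n C).filter P).card =
      (C.filter fun c => P (firstKey n c)).card + (C.filter fun c => P (secondKey n c)).card := by
  rw [keys, filter_union, card_union_of_disjoint]
  · rw [filter_image, filter_image, card_image_of_injOn, card_image_of_injOn]
    · exact (secondKey_injOn hC).mono fun c hc => (mem_filter.1 hc).1
    · exact (firstKey_injOn hC).mono fun c hc => (mem_filter.1 hc).1
  · rw [disjoint_left]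
    intro κ h1 h2
    obtain ⟨c, hc, rfl⟩ := mem_image.1 (mem_filter.1 h1).1
    obtain ⟨d, hd, h⟩ := mem_image.1 (mem_filter.1 h2).1
    exact firstKey_ne_secondKey hC hc hd h.symm

theorem card_keys (hC : ∀ c ∈ C, c.1 < c.2 ∧ c.2 < n) : (keys n C).card = 2 * C.card := by
  have := card_filter_keys hC fun _ => True
  simp only [filter_true] at this
  omega

/-- The position of an end with a given key. -/
def pos (n κ : ℕ) : ℕ := κ / (2 * n)

theorem pos_eq {p t : ℕ} (ht : t < 2 * n) : pos n (p * (2 * n) + t) = p := by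
  rw [pos, mul_comm, Nat.mul_add_div (by omega), Nat.div_eq_of_lt ht, add_zero]

theorem pos_firstKey (hC : ∀ c ∈ C, c.1 < c.2 ∧ c.2 < n) {c : ℕ × ℕ} (hc : c ∈ C) :
    pos n (firstKey n c) = c.1 := by
  have := hC c hc
  exact pos_eq (by omega)

theorem pos_secondKey (hC : ∀ c ∈ C, c.1 < c.2 ∧ c.2 < n) {c : ℕ × ℕ} (hc : c ∈ C) :
    pos n (secondKey n c) = c.2 := by
  have := hC c hc
  exact pos_eq (by omega)

theorem pos_mono {κ κ' : ℕ} (h : κ ≤ κ') : pos n κ ≤ pos n κ' := Nat.div_le_div_right h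

theorem lt_iff_pos_le (hn : 0 < n) {κ x : ℕ} : κ < (x + 1) * (2 * n) ↔ pos n κ ≤ x := by
  rw [pos, ← Nat.div_lt_iff_lt_mul (by omega), Nat.lt_succ_iff]

theorem pos_lt_of_mem (hC : ∀ c ∈ C, c.1 < c.2 ∧ c.2 < n) {κ : ℕ} (hκ : κ ∈ keys n C) :
    pos n κ < n := by
  rcases mem_union.1 hκ with h | h <;> obtain ⟨c, hc, rfl⟩ := mem_image.1 h
  · rw [pos_firstKey hC hc]; have := hC c hc; omega
  · rw [pos_secondKey hC hc]; exact (hC c hc).2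

/-- The number of ends at the positions up to `x`. -/
def idx (n : ℕ) (C : Finset (ℕ × ℕ)) (x : ℕ) : ℕ := rk (keys n C) ((x + 1) * (2 * n))

theorem rk_lt_idx_iff (hn : 0 < n) {κ x : ℕ} (hκ : κ ∈ keys n C) :
    rk (keys n C) κ < idx n C x ↔ pos n κ ≤ x := by
  rw [idx, rk_lt_iff hκ, lt_iff_pos_le hn]

theorem idx_le (x : ℕ) : idx n C x ≤ (keys n C).card := card_le_card (filter_subset _ _)

/-- The gap between ends of chords that contains the edge `{x, x + 1}`. -/
def gap (n : ℕ) (C : Finset (ℕ × ℕ)) (x : ℕ) : ℕ :=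
  if idx n C x = 0 then 2 * C.card - 1 else idx n C x - 1

/-- The length of the gap `r`. -/
def gapLength (n : ℕ) (C : Finset (ℕ × ℕ)) (r : ℕ) : ℕ :=
  ((range n).filter fun x => gap n C x = r).card

/-- A chord in terms of the ranks of its ends. -/
def ranked (n : ℕ) (C : Finset (ℕ × ℕ)) (c : ℕ × ℕ) : ℕ × ℕ :=
  (rk (keys n C) (firstKey n c), rk (keys n C) (secondKey n c))

theorem firstKey_mem {c : ℕ × ℕ} (hc : c ∈ C) : firstKey n c ∈ keys n C :=
  mem_union_left _ (mem_image_of_mem _ hc)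

theorem secondKey_mem {c : ℕ × ℕ} (hc : c ∈ C) : secondKey n c ∈ keys n C :=
  mem_union_right _ (mem_image_of_mem _ hc)

theorem ranked_injOn (hC : ∀ c ∈ C, c.1 < c.2 ∧ c.2 < n) : Set.InjOn (ranked n C) C :=
  fun _ hc _ hd h => firstKey_injOn hC hc hd
    (rk_inj (firstKey_mem hc) (firstKey_mem hd) (congrArg Prod.fst h))

theorem ranked_lt (hC : ∀ c ∈ C, c.1 < c.2 ∧ c.2 < n) {c : ℕ × ℕ} (hc : c ∈ C) :
    (ranked n C c).1 < (ranked n C c).2 ∧ (ranked n C c).2 < 2 * C.card := by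
  refine ⟨(rk_lt_iff (firstKey_mem hc)).2 ?_, card_keys hC ▸ rk_lt_card (secondKey_mem hc)⟩
  by_contra h
  have h1 := pos_mono (n := n) (not_lt.1 h)
  rw [pos_firstKey hC hc, pos_secondKey hC hc] at h1
  have := hC c hc
  omega

theorem gap_lt (hC : ∀ c ∈ C, c.1 < c.2 ∧ c.2 < n) (hk : 0 < C.card) (x : ℕ) :
    gap n C x < 2 * C.card := by
  have h1 := idx_le (n := n) (C := C) x
  rw [card_keys hC] at h1
  unfold gap
  split_ifs <;> omega

/-- An end has rank below `idx n C x` exactly when its position is at most x. The last gap wraps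
around to the edges before all ends; its index lies in no rank interval, just as those edges lie in
no chord interval. -/
theorem gap_inside_iff (hn : 0 < n) (hC : ∀ c ∈ C, c.1 < c.2 ∧ c.2 < n) {c : ℕ × ℕ} (hc : c ∈ C)
    (x : ℕ) : ((ranked n C c).1 ≤ gap n C x ∧ gap n C x < (ranked n C c).2) ↔
      (c.1 ≤ x ∧ x < c.2) := by
  have h1 := rk_lt_idx_iff hn (x := x) (firstKey_mem (n := n) hc)
  have h2 := rk_lt_idx_iff hn (x := x) (secondKey_mem (n := n) hc)
  have h3 := ranked_lt hC hc
  rw [pos_firstKey hC hc] at h1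
  rw [pos_secondKey hC hc] at h2
  simp only [ranked] at h3 ⊢
  unfold gap
  split_ifs <;> omega

theorem card_filter_ranked (hn : 0 < n) (hC : ∀ c ∈ C, c.1 < c.2 ∧ c.2 < n) {S : Finset (ℕ × ℕ)}
    (hS : S ⊆ C) (x : ℕ) : ((S.image (ranked n C)).filter fun c =>
      c.1 ≤ gap n C x ∧ gap n C x < c.2).card = covering S x := by
  rw [filter_image, card_image_of_injOn ((ranked_injOn hC).mono fun c hc =>
    hS (mem_filter.1 hc).1), covering]
  congr 1
  exact filter_congr fun c hc => gap_inside_iff hn hC (hS hc) x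

/-- Ends with consecutive ranks at different positions have a gap between them. -/
theorem gap_eq_of_pos_lt (hn : 0 < n) {κ κ' r : ℕ} (hκ : κ ∈ keys n C) (hκ' : κ' ∈ keys n C)
    (hr : rk (keys n C) κ = r) (hr' : rk (keys n C) κ' = r + 1) {x : ℕ} :
    pos n κ ≤ x ∧ x < pos n κ' ↔ idx n C x = r + 1 := by
  have h1 := rk_lt_idx_iff hn (x := x) hκ
  have h2 := rk_lt_idx_iff hn (x := x) hκ'
  omega

theorem gapLength_pos (hn : 0 < n) (hC : ∀ c ∈ C, c.1 < c.2 ∧ c.2 < n) {κ κ' r : ℕ}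
    (hκ : κ ∈ keys n C) (hκ' : κ' ∈ keys n C) (hr : rk (keys n C) κ = r)
    (hr' : rk (keys n C) κ' = r + 1) (hlt : pos n κ < pos n κ') : 1 ≤ gapLength n C r := by
  refine card_pos.2 ⟨pos n κ, mem_filter.2 ⟨mem_range.2 (pos_lt_of_mem hC hκ), ?_⟩⟩
  have := (gap_eq_of_pos_lt hn hκ hκ' hr hr').1 ⟨le_rfl, hlt⟩
  simp [gap, this]

theorem gap_last (hn : 0 < n) (hC : ∀ c ∈ C, c.1 < c.2 ∧ c.2 < n) (hk : 0 < C.card) {x : ℕ}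
    (hx : ∀ κ ∈ keys n C, pos n κ ≤ x) : gap n C x = 2 * C.card - 1 := by
  have : idx n C x = 2 * C.card := by
    rw [← card_keys hC, idx, rk, filter_true_of_mem]
    exact fun κ hκ => (lt_iff_pos_le hn).2 (hx κ hκ)
  unfold gap
  rw [this]
  split_ifs <;> omega

theorem keys_mono {S T : Finset (ℕ × ℕ)} (h : S ⊆ T) : keys n S ⊆ keys n T :=
  union_subset_union (image_subset_image h) (image_subset_image h)

/-- A gap other than the last is the stretch between two ends of consecutive rank. It has no end
inside, so by `longest` the stretch of equal length before 0 has none either, and that stretch lies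
in the last gap. -/
theorem gapLength_le_last (h : ChordSystem n C) (hn : 0 < n) (hk : 0 < C.card) {r : ℕ}
    (hr : r < 2 * C.card) : gapLength n C r ≤ gapLength n C (2 * C.card - 1) := by
  have hC := h.lt
  by_cases hlast : r = 2 * C.card - 1
  · rw [hlast]
  have hK := card_keys hC
  obtain ⟨κ, hκ, hκr⟩ := exists_rk_eq (K := keys n C) (r := r) (by omega)
  obtain ⟨κ', hκ', hκr'⟩ := exists_rk_eq (K := keys n C) (r := r + 1) (by omega)
  have hp' := pos_lt_of_mem hC hκ'
  have hle : pos n κ ≤ pos n κ' := pos_mono ((rk_lt_iff hκ).1 (by omega)).le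
  have h1 : gapLength n C r ≤ pos n κ' - pos n κ := by
    rw [← Nat.card_Ico]
    refine card_le_card fun x hx => ?_
    rw [mem_filter] at hx
    have h2 : idx n C x = r + 1 := by
      have := hx.2
      unfold gap at this
      split_ifs at this <;> omega
    exact mem_Ico.2 ((gap_eq_of_pos_lt hn hκ hκ' hκr hκr').2 h2)
  refine h1.trans ?_
  have hfree := h.longest (pos n κ) (pos n κ' - pos n κ) (by omega) (by
    intro y hy1 hy2 c hc
    have key : ∀ μ ∈ keys n C, pos n μ ≠ y := by
      rintro μ hμ rfl
      have h3 := (gap_eq_of_pos_lt hn hκ hκ' hκr hκr' (x := pos n μ)).1 ⟨by omega, by omega⟩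
      have h4 := (rk_lt_idx_iff hn hμ (x := pos n μ)).2 le_rfl
      have h5 : κ < μ := by
        by_contra hlt
        have := pos_mono (n := n) (not_lt.1 hlt)
        omega
      have := (rk_lt_iff hκ).2 h5
      omega
    exact ⟨pos_firstKey hC hc ▸ key _ (firstKey_mem hc),
      pos_secondKey hC hc ▸ key _ (secondKey_mem hc)⟩)
  have h6 : pos n κ' - pos n κ = (Ico (n - (pos n κ' - pos n κ)) n).card := by
    rw [Nat.card_Ico]; omega
  rw [h6]
  refine card_le_card fun x hx => ?_
  rw [mem_Ico] at hx
  refine mem_filter.2 ⟨mem_range.2 hx.2, gap_last hn hC hk fun μ hμ => ?_⟩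
  by_contra hlt
  have hμn := pos_lt_of_mem hC hμ
  have h7 := hfree (pos n μ) (by omega) hμn
  rcases mem_union.1 hμ with hm | hm <;> obtain ⟨c, hc, rfl⟩ := mem_image.1 hm
  · exact (h7 c hc).1 (pos_firstKey hC hc).symm
  · exact (h7 c hc).2 (pos_secondKey hC hc).symm

/-- At a common vertex the keys put second ends before first ends, and the inner chord opens last
and closes first. So chords that cross by rank have four distinct ends, and the gap between adjacent
ends of the two is positive. The last gap contains the edge {n - 1, 0}. -/
theorem gapLength_pos_of_positive (hn : 0 < n) (hC : ∀ c ∈ C, c.1 < c.2 ∧ c.2 < n)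
    (hk : 0 < C.card) {l : List (ℕ × ℕ)} (hl : ∀ c ∈ l, c ∈ C.image (ranked n C)) {r : ℕ}
    (hp : positive (2 * C.card) l r = true) : 1 ≤ gapLength n C r := by
  simp only [positive, Bool.or_eq_true, List.any_eq_true, Bool.and_eq_true, Nat.beq_eq,
    Nat.blt_eq] at hp
  rcases hp with hp | ⟨c', hc', d', hd', ⟨⟨h1, h2⟩, h3⟩, h4⟩
  · refine card_pos.2 ⟨n - 1, mem_filter.2 ⟨mem_range.2 (by omega), ?_⟩⟩
    rw [gap_last hn hC hk fun κ hκ => Nat.le_sub_one_of_lt (pos_lt_of_mem hC hκ)]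
    omega
  · obtain ⟨c, hc, rfl⟩ := mem_image.1 (hl c' hc')
    obtain ⟨d, hd, rfl⟩ := mem_image.1 (hl d' hd')
    have hc1 := hC c hc
    have hd1 := hC d hd
    simp only [ranked] at h1 h2 h3 h4
    have k1 := (rk_lt_iff (firstKey_mem hc)).1 h1
    have k2 := (rk_lt_iff (firstKey_mem hd)).1 h2
    have k3 := (rk_lt_iff (secondKey_mem hc)).1 h3
    have q1 := key_cases (by omega) k1
    have q2 := key_cases (by omega) k2
    have q3 := key_cases (by omega) k3
    rcases h4 with (h4 | h4) | h4
    · refine gapLength_pos hn hC (firstKey_mem hc) (firstKey_mem hd) h4.1 h4.2 ?_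
      rw [pos_firstKey hC hc, pos_firstKey hC hd]
      omega
    · refine gapLength_pos hn hC (firstKey_mem hd) (secondKey_mem hc) h4.1 h4.2 ?_
      rw [pos_firstKey hC hd, pos_secondKey hC hc]
      omega
    · refine gapLength_pos hn hC (secondKey_mem hc) (secondKey_mem hd) h4.1 h4.2 ?_
      rw [pos_secondKey hC hc, pos_secondKey hC hd]
      omega

theorem par_eq {l : List (ℕ × ℕ)} (hl : l.Nodup) (r : ℕ) :
    par l r = decide (Odd (l.toFinset.filter fun c => c.1 ≤ r ∧ r < c.2).card) := by
  induction l with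
  | nil => simp [par]
  | cons c l ih =>
    rw [List.nodup_cons] at hl
    change xor (Nat.ble c.1 r && Nat.blt r c.2) (par l r) = _
    have e : (Nat.ble c.1 r && Nat.blt r c.2) = decide (c.1 ≤ r ∧ r < c.2) := by
      rw [Bool.eq_iff_iff, Bool.and_eq_true, Nat.ble_eq, Nat.blt_eq, decide_eq_true_iff]
    rw [ih hl.2, e, List.toFinset_cons, filter_insert]
    split_ifs with hc
    · rw [card_insert_of_notMem (by
        rw [mem_filter, List.mem_toFinset]; exact fun h => hl.1 h.1)]
      rw [decide_eq_true hc, Bool.true_xor, ← decide_not, decide_eq_decide, Nat.odd_add_one]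
    · rw [decide_eq_false hc, Bool.false_xor]

end Keys


/-! ### From cycles of the graph to candidates of its chord diagram -/

section Realize

variable {n : ℕ} {C : Finset (ℕ × ℕ)}

theorem xor_par_gap (hn : 0 < n) (hC : ∀ c ∈ C, c.1 < c.2 ∧ c.2 < n) {S : Finset (ℕ × ℕ)}
    (hS : S ⊆ C) {L : List (ℕ × ℕ)} (hL : L.Nodup) (hLS : L.toFinset = S.image (ranked n C))
    (x : ℕ) : par L (gap n C x) = decide (Odd (covering S x)) := by
  rw [par_eq hL, hLS, card_filter_ranked hn hC hS]

theorem exists_subset_of_sublist {S : Finset (ℕ × ℕ)} {L T : List (ℕ × ℕ)} (hL : L.Nodup)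
    (hLS : L.toFinset = S.image (ranked n C)) (hT : T.Sublist L) :
    ∃ T' ⊆ S, T.toFinset = T'.image (ranked n C) ∧ T.Nodup := by
  have h1 : T.toFinset ⊆ S.image (ranked n C) := by
    rw [← hLS]
    exact fun c hc => List.mem_toFinset.2 (hT.subset (List.mem_toFinset.1 hc))
  obtain ⟨T', hT', h2⟩ := subset_image_iff.1 h1
  exact ⟨T', hT', h2.symm, hL.sublist hT⟩

/-- Moving from r to i, membership in the interval changes once for each of A and B that is passed.
-/
theorem even_interval_count {A B r i : ℕ} (hAB : A < B) (hri : r ≤ i) :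
    Even ((if A ≤ r ∧ r < B then 1 else 0) + (if A ≤ i ∧ i < B then 1 else 0) +
      ((if r < A ∧ A ≤ i then 1 else 0) + if r < B ∧ B ≤ i then 1 else 0)) := by
  rw [Nat.even_iff]
  split_ifs <;> omega

/-- If a gap has length zero and both its ends belong to chords of a cycle, then the edge after it
is not in the cycle, although the parity says that it differs from the gap. -/
theorem nonzero_gap (hn : 0 < n) (hC : ∀ c ∈ C, c.1 < c.2 ∧ c.2 < n) {S : Finset (ℕ × ℕ)}
    (hS : S ⊆ C) {X : ℕ → Bool} (hdeg : ∀ v < n, degree n S X v = 0 ∨ degree n S X v = 2)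
    {L : List (ℕ × ℕ)} (hL : L.Nodup) (hLS : L.toFinset = S.image (ranked n C)) {b : Bool}
    (hX : ∀ x < n, X x = xor b (par L (gap n C x))) {r : ℕ} (hr : xor b (par L r) = false)
    (h₁ : ∃ c ∈ L, c.1 = r ∨ c.2 = r) (h₂ : ∃ c ∈ L, c.1 = r + 1 ∨ c.2 = r + 1) :
    gapLength n C r ≠ 0 := by
  intro hzero
  have hSC : ∀ c ∈ S, c.1 < c.2 ∧ c.2 < n := fun c hc => hC c (hS hc)
  have hend : ∀ r, (∃ c ∈ L, c.1 = r ∨ c.2 = r) → ∃ κ ∈ keys n S, rk (keys n C) κ = r := by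
    rintro r ⟨c', hc', hcr⟩
    rw [← List.mem_toFinset, hLS] at hc'
    obtain ⟨c, hc, rfl⟩ := mem_image.1 hc'
    rcases hcr with h | h
    · exact ⟨_, firstKey_mem hc, h⟩
    · exact ⟨_, secondKey_mem hc, h⟩
  obtain ⟨κ, hκ, hκr⟩ := hend r h₁
  obtain ⟨κ', hκ', hκr'⟩ := hend (r + 1) h₂
  have hκC := keys_mono (n := n) hS hκ
  have hκC' := keys_mono (n := n) hS hκ'
  have hlt : κ < κ' := (rk_lt_iff hκC).1 (by omega)
  have hpos : pos n κ = pos n κ' := by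
    by_contra hne
    have h3 := pos_mono (n := n) hlt.le
    have := gapLength_pos hn hC hκC hκC' hκr hκr' (by omega)
    omega
  set v := pos n κ' with hv
  have hvn : v < n := pos_lt_of_mem hC hκC'
  have hcard : ((keys n S).filter fun μ => pos n μ = v).card =
      (S.filter fun c => c.1 = v).card + (S.filter fun c => c.2 = v).card := by
    rw [card_filter_keys hSC]
    congr 2
    · exact filter_congr fun c hc => by rw [pos_firstKey hSC hc]
    · exact filter_congr fun c hc => by rw [pos_secondKey hSC hc]
  have hsub : ({κ, κ'} : Finset ℕ) ⊆ (keys n S).filter fun μ => pos n μ = v := by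
    intro μ hμ
    rw [mem_insert, mem_singleton] at hμ
    rcases hμ with rfl | rfl
    · exact mem_filter.2 ⟨hκ, hpos⟩
    · exact mem_filter.2 ⟨hκ', rfl⟩
  have htwo : ({κ, κ'} : Finset ℕ).card = 2 := card_pair hlt.ne
  have hle := card_le_card hsub
  have hdv := hdeg v hvn
  unfold degree at hdv
  -- The two ends at v already use up the degree 2.
  have hXv : X v = false := by
    rw [← Bool.not_eq_true]
    intro h
    rw [h, Bool.toNat_true] at hdv
    omega
  have heq : ({κ, κ'} : Finset ℕ) = (keys n S).filter fun μ => pos n μ = v :=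
    eq_of_subset_of_card_le hsub (by omega)
  have hidx : r + 1 < idx n C v := by
    have := (rk_lt_idx_iff hn hκC' (x := v)).2 le_rfl
    omega
  have hgap : gap n C v = idx n C v - 1 := by
    unfold gap
    rw [if_neg (by omega)]
  -- There is no third end of S at v, so exactly one end, κ', separates the gap r from the gap of
  -- the edge {v, v + 1}. The parities of the two gaps then differ, while neither belongs to the
  -- cycle.
  have hone : ((keys n S).filter fun μ => r < rk (keys n C) μ ∧ rk (keys n C) μ ≤ gap n C v) =
      {κ'} := by
    ext μ
    rw [mem_filter, mem_singleton]
    constructor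
    · rintro ⟨hμ, h3, h4⟩
      have hμC := keys_mono (n := n) hS hμ
      have h5 : κ < μ := (rk_lt_iff hκC).1 (by omega)
      have h6 := pos_mono (n := n) h5.le
      have h7 := (rk_lt_idx_iff hn hμC (x := v)).1 (by omega)
      have h8 : μ ∈ ({κ, κ'} : Finset ℕ) := by
        rw [heq, mem_filter]
        exact ⟨hμ, by omega⟩
      rw [mem_insert, mem_singleton] at h8
      omega
    · rintro rfl
      exact ⟨hκ', by omega, by omega⟩
  have hcount := congrArg Finset.card hone
  rw [card_filter_keys hSC, card_singleton] at hcount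
  have hpar : Even ((S.filter fun c => (ranked n C c).1 ≤ r ∧ r < (ranked n C c).2).card +
      (S.filter fun c => (ranked n C c).1 ≤ gap n C v ∧ gap n C v < (ranked n C c).2).card +
      ((S.filter fun c => r < rk (keys n C) (firstKey n c) ∧
        rk (keys n C) (firstKey n c) ≤ gap n C v).card +
      (S.filter fun c => r < rk (keys n C) (secondKey n c) ∧
        rk (keys n C) (secondKey n c) ≤ gap n C v).card)) := by
    simp only [card_filter, ← sum_add_distrib]
    refine even_sum _ fun c hc => ?_
    exact even_interval_count (ranked_lt hC (hS hc)).1 (by omega)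
  rw [hcount] at hpar
  have himage : ∀ i, par L i = decide (Odd
      (S.filter fun c => (ranked n C c).1 ≤ i ∧ i < (ranked n C c).2).card) := by
    intro i
    rw [par_eq hL, hLS, filter_image, card_image_of_injOn ((ranked_injOn hC).mono fun c hc =>
      hS (mem_filter.1 hc).1)]
  have hx := hX v hvn
  rw [hXv] at hx
  have hparity : par L (gap n C v) = par L r := by
    revert hr hx
    cases b <;> cases par L r <;> cases par L (gap n C v) <;> simp
  rw [himage, himage, decide_eq_decide] at hparity
  rw [Nat.even_add_one, Nat.not_even_iff_odd, Nat.odd_add] at hpar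
  rw [← Nat.not_odd_iff_even] at hpar
  tauto

/-- The matching is the rank image of C. Whether an edge lies in a cycle depends only on its gap, so
counting edges by gap turns cycle lengths into sums of gap lengths. -/
theorem ChordSystem.exists_feasible (h : ChordSystem n C) (hk : 0 < C.card)
    (hk255 : 2 * C.card < 255) (hn255 : n < 255) {ns : List ℕ} (hns : n ∈ ns) :
    ∃ l ∈ matchings C.card (List.range (2 * C.card)), feasible (2 * C.card)
      ((List.range (2 * C.card)).map fun i => 256 ^ i) (List.range (2 * C.card - 1)) ns l =
        true := by
  have hC := h.lt
  obtain ⟨c₀, hc₀⟩ := card_pos.1 hk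
  have hn : 0 < n := by
    have := hC c₀ hc₀
    omega
  have hK := card_keys hC
  obtain ⟨l, hl, hlnd, hlM⟩ := exists_mem_matchings C.card (List.range (2 * C.card))
    (C.image (ranked n C)) List.pairwise_lt_range (List.length_range)
    (by
      intro c' hc'
      obtain ⟨c, hc, rfl⟩ := mem_image.1 hc'
      have := ranked_lt hC hc
      simp only [List.mem_range]
      omega)
    (by
      intro r hr
      rw [List.mem_range] at hr
      obtain ⟨κ, hκ, hκr⟩ := exists_rk_eq (K := keys n C) (r := r) (by omega)
      rcases mem_union.1 hκ with hm | hm <;> obtain ⟨c, hc, rfl⟩ := mem_image.1 hm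
      · exact ⟨_, mem_image_of_mem _ hc, Or.inl hκr⟩
      · exact ⟨_, mem_image_of_mem _ hc, Or.inr hκr⟩)
    (by
      intro c' hc' d' hd' r hcr hdr
      obtain ⟨c, hc, rfl⟩ := mem_image.1 hc'
      obtain ⟨d, hd, rfl⟩ := mem_image.1 hd'
      have f1 := firstKey_mem (n := n) hc
      have f2 := firstKey_mem (n := n) hd
      have s1 := secondKey_mem (n := n) hc
      have s2 := secondKey_mem (n := n) hd
      have hcd : c = d := by
        rcases hcr with hcr | hcr <;> rcases hdr with hdr | hdr
        · exact firstKey_injOn hC hc hd (rk_inj f1 f2 (hcr.trans hdr.symm))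
        · exact absurd (rk_inj f1 s2 (hcr.trans hdr.symm)) (firstKey_ne_secondKey hC hc hd)
        · exact absurd (rk_inj s1 f2 (hcr.trans hdr.symm)).symm (firstKey_ne_secondKey hC hd hc)
        · exact secondKey_injOn hC hc hd (rk_inj s1 s2 (hcr.trans hdr.symm))
      rw [hcd])
  have hmem : ∀ c ∈ l, c ∈ C.image (ranked n C) := fun c hc => by
    rw [← hlM]; exact List.mem_toFinset.2 hc
  refine ⟨l, hl, feasible_of_realizes (n := n) (g := gapLength n C) ?_ hns (by omega) hk255 hn255 ?_
    ?_ ?_ ?_⟩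
  · intro c' hc'
    obtain ⟨c, hc, rfl⟩ := mem_image.1 (hmem c' hc')
    exact ranked_lt hC hc
  · unfold gapLength
    rw [← card_eq_sum_card_fiberwise (f := gap n C) (s := range n) (t := range (2 * C.card))
      fun x _ => mem_coe.2 (mem_range.2 (gap_lt hC hk x)), card_range]
  · exact fun r _ hp => gapLength_pos_of_positive hn hC hk hmem hp
  · exact fun r hr => gapLength_le_last h hn hk hr
  · intro len h3 hlen
    obtain ⟨S, hS, hSne, X, hX, hdeg, hmin⟩ := h.cover len h3 hlen
    have hSC : ∀ c ∈ S, c.1 < c.2 ∧ c.2 < n := fun c hc => hC c (hS hc)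
    set L := l.filter fun c => c ∈ S.image (ranked n C) with hLdef
    have hLnd : L.Nodup := hlnd.filter _
    have hLS : L.toFinset = S.image (ranked n C) := by
      ext c
      rw [List.mem_toFinset, hLdef, List.mem_filter, decide_eq_true_iff, and_iff_right_iff_imp]
      intro hc
      rw [← List.mem_toFinset, hlM]
      exact image_subset_image hS hc
    have hLlen : L.length = S.card := by
      rw [← List.toFinset_card_of_nodup hLnd, hLS, card_image_of_injOn
        ((ranked_injOn hC).mono hS)]
    have hXpar : ∀ x < n, X x = xor (X (n - 1)) (par L (gap n C x)) := by
      intro x hx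
      rw [xor_par_gap hn hC hS hLnd hLS]
      refine eq_xor_covering (fun c hc => (hSC c hc).1) (fun v hv => ?_) x hx
      rcases hdeg v hv with h0 | h0 <;> rw [h0] <;> decide
    refine ⟨L, List.filter_sublist, ?_, X (n - 1), ?_, ?_, ?_⟩
    · intro h0
      rw [h0, List.length_nil] at hLlen
      exact absurd hLlen.symm (card_pos.2 hSne).ne'
    · rw [hLlen, ← hX]
      congr 1
      have h4 : ((range n).filter fun x => X x = true) = (range n).filter fun x =>
          xor (X (n - 1)) (par L (gap n C x)) = true :=
        filter_congr fun x hx => by rw [hXpar x (mem_range.1 hx)]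
      rw [h4, card_eq_sum_card_fiberwise (f := gap n C) (t := range (2 * C.card))
        fun x _ => mem_coe.2 (mem_range.2 (gap_lt hC hk x))]
      refine sum_congr rfl fun r _ => ?_
      rw [filter_filter]
      dsimp only
      cases hb : xor (X (n - 1)) (par L r) with
      | false =>
        rw [cond_false, eq_comm, card_eq_zero, filter_eq_empty_iff]
        rintro x _ ⟨h5, h6⟩
        rw [h6, hb] at h5
        exact absurd h5 (by simp)
      | true =>
        rw [cond_true, gapLength]
        congr 1
        refine filter_congr fun x _ => ⟨fun h6 => ⟨by rw [h6, hb], h6⟩, fun h6 => h6.2⟩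
    · intro T hT hTne hTlen b'
      obtain ⟨T', hT'S, hTT', hTnd⟩ := exists_subset_of_sublist hLnd hLS hT
      have hTcard : T.length = T'.card := by
        rw [← List.toFinset_card_of_nodup hTnd, hTT', card_image_of_injOn
          ((ranked_injOn hC).mono (hT'S.trans hS))]
      have hTC : ∀ c ∈ T', c.1 < c.2 ∧ c.2 < n := fun c hc => hSC c (hT'S hc)
      -- By `even_degree` each mask of a smaller set of chords comes from an even edge set, to which
      -- the minimality of the cycle applies.
      obtain ⟨x, hx, hY, hXx⟩ := hmin T' hT'S (card_pos.1 (by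
          rw [← hTcard]; exact List.length_pos_iff.2 hTne)) (fun e => by rw [e] at hTcard; omega)
        (fun x => xor b' (decide (Odd (covering T' x)))) (fun v _ => even_degree hTC b' v)
      refine ⟨gap n C x, gap_lt hC hk x, ?_, ?_⟩
      · rw [xor_par_gap hn hC (hT'S.trans hS) hTnd hTT']
        exact hY
      · rw [← hXpar x hx]
        exact hXx
    · intro r _ hr h₁ h₂
      exact nonzero_gap hn hC hS hdeg hLnd hLS hXpar hr h₁ h₂

end Realize


/-! ### Closed paths -/

section Ring

variable {V : Type*}

/-- `f 0, …, f (m - 1)` are distinct, and `f m = f 0`. -/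
structure IsRing (m : ℕ) (f : ℕ → V) : Prop where
  three_le : 3 ≤ m
  inj : ∀ i < m, ∀ j < m, f i = f j → i = j
  closed : f m = f 0

variable {m : ℕ} {f : ℕ → V}

theorem IsRing.apply_eq_apply_succ (h : IsRing m f) {v x : ℕ} (hv : v < m) (hx : x < m) :
    f v = f (x + 1) ↔ x = prev m v := by
  have h3 := h.three_le
  unfold prev
  rcases Nat.lt_or_ge (x + 1) m with hlt | hge
  · constructor
    · intro he
      have := h.inj _ hv _ hlt he
      split_ifs <;> omega
    · intro he
      congr 1
      split_ifs at he <;> omega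
  · have hxm : x + 1 = m := by omega
    rw [hxm, h.closed]
    constructor
    · intro he
      have := h.inj _ hv _ (by omega) he
      rw [if_pos this]
      omega
    · intro he
      congr 1
      split_ifs at he <;> omega

theorem IsRing.apply_mem (h : IsRing m f) {v x : ℕ} (hv : v < m) (hx : x < m) :
    f v ∈ s(f x, f (x + 1)) ↔ x = v ∨ x = prev m v := by
  rw [Sym2.mem_iff, h.apply_eq_apply_succ hv hx]
  refine or_congr_left ⟨fun he => (h.inj _ hv _ hx he).symm, fun he => by rw [he]⟩

theorem prev_lt {m v : ℕ} (hv : v < m) : prev m v < m := by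
  unfold prev
  split_ifs <;> omega

theorem prev_ne {m v : ℕ} (hm : 3 ≤ m) : prev m v ≠ v := by
  unfold prev
  split_ifs <;> omega

theorem IsRing.edge_inj (h : IsRing m f) {x y : ℕ} (hx : x < m) (hy : y < m)
    (he : s(f x, f (x + 1)) = s(f y, f (y + 1))) : x = y := by
  have h3 := h.three_le
  have h1 : f x ∈ s(f y, f (y + 1)) := he ▸ Sym2.mem_mk_left _ _
  have h2 : f y ∈ s(f x, f (x + 1)) := he ▸ Sym2.mem_mk_left _ _
  rw [h.apply_mem hx hy] at h1
  rw [h.apply_mem hy hx] at h2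
  unfold prev at h1 h2
  split_ifs at h1 h2 <;> omega

/-- The pairs in `T` are chords of the closed path. -/
def IsChords (m : ℕ) (f : ℕ → V) (T : Finset (ℕ × ℕ)) : Prop :=
  ∀ c ∈ T, (c.1 < c.2 ∧ c.2 < m) ∧ ∀ x < m, s(f c.1, f c.2) ≠ s(f x, f (x + 1))

theorem IsChords.mono {S T : Finset (ℕ × ℕ)} (h : IsChords m f T) (hS : S ⊆ T) :
    IsChords m f S := fun c hc => h c (hS hc)

theorem IsRing.apply_mem_chord (h : IsRing m f) {T : Finset (ℕ × ℕ)} (hT : IsChords m f T)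
    {v : ℕ} (hv : v < m) {c : ℕ × ℕ} (hc : c ∈ T) :
    f v ∈ s(f c.1, f c.2) ↔ c.1 = v ∨ c.2 = v := by
  have hlt := (hT c hc).1
  rw [Sym2.mem_iff]
  refine or_congr ⟨fun he => (h.inj _ hv _ (by omega) he).symm, fun he => by rw [he]⟩
    ⟨fun he => (h.inj _ hv _ (by omega) he).symm, fun he => by rw [he]⟩

theorem IsRing.chord_injOn (h : IsRing m f) {T : Finset (ℕ × ℕ)} (hT : IsChords m f T) :
    Set.InjOn (fun c : ℕ × ℕ => s(f c.1, f c.2)) T := by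
  intro c hc d hd he
  have h1 := (hT c hc).1
  have h2 := (hT d hd).1
  dsimp only at he
  rw [Sym2.eq_iff] at he
  rcases he with ⟨ha, hb⟩ | ⟨ha, hb⟩
  · exact Prod.ext (h.inj _ (by omega) _ (by omega) ha) (h.inj _ (by omega) _ (by omega) hb)
  · have := h.inj _ (by omega) _ (by omega) ha
    have := h.inj _ (by omega) _ (by omega) hb
    omega

theorem IsRing.edge_injOn (h : IsRing m f) (Y : ℕ → Bool) :
    Set.InjOn (fun x => s(f x, f (x + 1))) ((range m).filter fun x => Y x = true) :=
  fun _ hx _ hy he => h.edge_inj (mem_range.1 (mem_filter.1 (mem_coe.1 hx)).1)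
    (mem_range.1 (mem_filter.1 (mem_coe.1 hy)).1) he

theorem isChords_empty (m : ℕ) (f : ℕ → V) : IsChords m f ∅ := by
  intro c hc
  exact absurd hc (notMem_empty c)

variable [DecidableEq V]

/-- The chords in `T` and the edges of the closed path selected by `Y`. -/
def edgesOf (m : ℕ) (f : ℕ → V) (T : Finset (ℕ × ℕ)) (Y : ℕ → Bool) : Finset (Sym2 V) :=
  (T.image fun c => s(f c.1, f c.2)) ∪
    ((range m).filter fun x => Y x = true).image fun x => s(f x, f (x + 1))

theorem IsChords.disjoint {T : Finset (ℕ × ℕ)} (hT : IsChords m f T) (Y : ℕ → Bool) :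
    Disjoint (T.image fun c => s(f c.1, f c.2))
      (((range m).filter fun x => Y x = true).image fun x => s(f x, f (x + 1))) := by
  rw [disjoint_left]
  intro e he he'
  obtain ⟨c, hc, rfl⟩ := mem_image.1 he
  obtain ⟨x, hx, hxe⟩ := mem_image.1 he'
  exact (hT c hc).2 x (mem_range.1 (mem_filter.1 hx).1) hxe.symm

theorem IsRing.card_edgesOf (h : IsRing m f) {T : Finset (ℕ × ℕ)} (hT : IsChords m f T)
    (Y : ℕ → Bool) :
    (edgesOf m f T Y).card = T.card + ((range m).filter fun x => Y x = true).card := by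
  rw [edgesOf, card_union_of_disjoint (hT.disjoint Y), card_image_of_injOn (h.chord_injOn hT),
    card_image_of_injOn (h.edge_injOn Y)]

theorem IsRing.card_incident (h : IsRing m f) {T : Finset (ℕ × ℕ)} (hT : IsChords m f T)
    (Y : ℕ → Bool) {v : ℕ} (hv : v < m) :
    ((edgesOf m f T Y).filter fun e => f v ∈ e).card = degree m T Y v := by
  rw [edgesOf, filter_union, card_union_of_disjoint (disjoint_filter_filter (hT.disjoint Y)),
    filter_image, filter_image,
    card_image_of_injOn ((h.chord_injOn hT).mono (coe_subset.2 (filter_subset _ _))),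
    card_image_of_injOn ((h.edge_injOn Y).mono (coe_subset.2 (filter_subset _ _))), degree, add_comm]
  congr 1
  · rw [filter_filter]
    have h1 : ((range m).filter fun x => Y x = true ∧ f v ∈ s(f x, f (x + 1))) =
        ({v, prev m v} : Finset ℕ).filter fun x => Y x = true := by
      ext x
      simp only [mem_filter, mem_range, mem_insert, mem_singleton]
      constructor
      · rintro ⟨hx, hY, hm⟩
        exact ⟨(h.apply_mem hv hx).1 hm, hY⟩
      · rintro ⟨hx, hY⟩
        have hxm : x < m := by
          rcases hx with rfl | rfl
          · exact hv
          · exact prev_lt hv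
        exact ⟨hxm, hY, (h.apply_mem hv hxm).2 hx⟩
    rw [h1, card_filter, sum_pair (prev_ne h.three_le).symm]
    cases Y v <;> cases Y (prev m v) <;> rfl
  · rw [← card_union_of_disjoint, ← filter_or]
    · exact congrArg card (filter_congr fun c hc => h.apply_mem_chord hT hv hc)
    · rw [disjoint_filter]
      intro c hc h1 h2
      have := (hT c hc).1
      omega

theorem degree_empty (n : ℕ) (X : ℕ → Bool) (v : ℕ) :
    degree n ∅ X v = (X v).toNat + (X (prev n v)).toNat := by
  simp [degree]

theorem eq_last_of_even {n : ℕ} {X : ℕ → Bool} (hX : ∀ v < n, Even (degree n ∅ X v)) {x : ℕ}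
    (hx : x < n) : X x = X (n - 1) := by
  rw [eq_xor_covering (by simp) hX x hx]
  simp [covering]

theorem IsRing.card_incident_eq (h : IsRing m f) (u : V) :
    ((edgesOf m f ∅ fun _ => true).filter fun e => u ∈ e).card = 0 ∨
      ((edgesOf m f ∅ fun _ => true).filter fun e => u ∈ e).card = 2 := by
  by_cases hu : ∃ v < m, f v = u
  · obtain ⟨v, hv, rfl⟩ := hu
    right
    rw [h.card_incident (isChords_empty m f) _ hv, degree_empty]
    rfl
  · left
    rw [card_eq_zero, filter_eq_empty_iff]
    intro e he hue
    rw [edgesOf, image_empty, empty_union] at he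
    obtain ⟨x, hx, rfl⟩ := mem_image.1 he
    have hxm := mem_range.1 (mem_filter.1 hx).1
    rw [Sym2.mem_iff] at hue
    rcases hue with hue | hue
    · exact hu ⟨x, hxm, hue.symm⟩
    · rcases Nat.lt_or_ge (x + 1) m with hlt | hge
      · exact hu ⟨_, hlt, hue.symm⟩
      · rw [show x + 1 = m by omega, h.closed] at hue
        exact hu ⟨0, by omega, hue.symm⟩

/-- A nonempty set of edges of a cycle in which all degrees are even is the whole cycle. -/
theorem IsRing.eq_of_even (h : IsRing m f) {F : Finset (Sym2 V)}
    (hF : F ⊆ edgesOf m f ∅ fun _ => true) (hne : F.Nonempty)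
    (heven : ∀ u, Even (F.filter fun e => u ∈ e).card) : F = edgesOf m f ∅ fun _ => true := by
  have hrep : F = edgesOf m f ∅ fun x => decide (s(f x, f (x + 1)) ∈ F) := by
    ext e
    rw [edgesOf, image_empty, empty_union, mem_image]
    constructor
    · intro he
      have h1 := hF he
      rw [edgesOf, image_empty, empty_union] at h1
      obtain ⟨x, hx, rfl⟩ := mem_image.1 h1
      exact ⟨x, mem_filter.2 ⟨(mem_filter.1 hx).1, decide_eq_true he⟩, rfl⟩
    · rintro ⟨x, hx, rfl⟩
      exact of_decide_eq_true (mem_filter.1 hx).2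
  have hall : ∀ v < m, Even (degree m ∅ (fun x => decide (s(f x, f (x + 1)) ∈ F)) v) := by
    intro v hv
    rw [← h.card_incident (isChords_empty m f) _ hv, ← hrep]
    exact heven _
  -- With no chords the parity rule makes membership constant along the cycle, so one edge in F
  -- brings in all.
  have hconst := fun x (hx : x < m) => eq_last_of_even hall hx
  obtain ⟨e, he⟩ := hne
  have h1 := hF he
  rw [edgesOf, image_empty, empty_union] at h1
  obtain ⟨x, hx, rfl⟩ := mem_image.1 h1
  have hlast := hconst x (mem_range.1 (mem_filter.1 hx).1)
  refine Subset.antisymm hF fun e' he' => ?_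
  rw [edgesOf, image_empty, empty_union] at he'
  obtain ⟨y, hy, rfl⟩ := mem_image.1 he'
  have h2 := hconst y (mem_range.1 (mem_filter.1 hy).1)
  rw [← hlast] at h2
  rw [decide_eq_decide] at h2
  exact h2.2 he

end Ring

/-! ### Chord systems from pancyclic graphs -/

section Graph

variable {V : Type*} {G : SimpleGraph V}

theorem isRing_getVert {v : V} {p : G.Walk v v} (hp : p.IsCycle) : IsRing p.length p.getVert where
  three_le := hp.three_le_length
  inj i hi j hj he := by
    refine hp.getVert_injOn' ?_ ?_ he <;> simp only [Set.mem_ofPred_eq] <;> omega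
  closed := by rw [p.getVert_length, p.getVert_zero]

theorem edges_toFinset_eq [DecidableEq V] {v : V} (p : G.Walk v v) :
    p.edges.toFinset = edgesOf p.length p.getVert ∅ fun _ => true := by
  ext e
  rw [edgesOf, image_empty, empty_union, List.mem_toFinset, mem_image]
  induction e with | _ a b =>
  rw [SimpleGraph.Walk.mk_mem_edges_iff_exists]
  simp

/-- The periodic parametrization makes it possible to rotate the starting point. -/
theorem exists_periodic {v : V} {p : G.Walk v v} (hp : p.IsCycle) :
    ∃ f : ℕ → V, (∀ i, f (i % p.length) = f i) ∧ (∀ i < p.length, ∀ j < p.length, f i = f j → i = j) ∧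
      ∀ i, G.Adj (f i) (f (i + 1)) := by
  have h := isRing_getVert hp
  have h3 := h.three_le
  refine ⟨fun i => p.getVert (i % p.length), fun i => ?_, fun i hi j hj he => ?_, fun i => ?_⟩
  · dsimp only
    rw [Nat.mod_mod]
  · dsimp only at he
    rw [Nat.mod_eq_of_lt hi, Nat.mod_eq_of_lt hj] at he
    exact h.inj i hi j hj he
  · dsimp only
    have hi := Nat.mod_lt i (show 0 < p.length by omega)
    have hadj := p.adj_getVert_succ hi
    rcases Nat.lt_or_ge (i % p.length + 1) p.length with hlt | hge
    · rwa [Nat.add_mod, Nat.mod_eq_of_lt (show 1 < p.length by omega), Nat.mod_eq_of_lt hlt]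
    · have he : i % p.length + 1 = p.length := by omega
      rw [Nat.add_mod, Nat.mod_eq_of_lt (show 1 < p.length by omega), he, Nat.mod_self,
        ← h.closed]
      rwa [he] at hadj

theorem exists_lt_modEq {n : ℕ} (hn : 0 < n) (t x : ℕ) : ∃ y < n, (y + t) ≡ x [MOD n] := by
  refine ⟨(x + (n - 1) * t) % n, Nat.mod_lt _ hn, ?_⟩
  have h1 : (x + (n - 1) * t) % n + t ≡ x + (n - 1) * t + t [MOD n] :=
    (Nat.mod_modEq _ _).add_right t
  refine h1.trans ?_
  obtain ⟨m, rfl⟩ : ∃ m, n = m + 1 := ⟨n - 1, by omega⟩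
  rw [Nat.add_sub_cancel, show x + m * t + t = x + t * (m + 1) by ring]
  exact Nat.add_mul_modulus_modEq_iff.2 rfl

/-- The chords of a Hamiltonian cycle in a pancyclic graph, in a labelling of the cycle in which the
longest stretch without ends of chords is the last one. -/
theorem exists_chordSystem {n : ℕ} {G : SimpleGraph (Fin n)} (hn : 3 ≤ n) (hG : IsPancyclic G) :
    ∃ C, ChordSystem n C ∧ G.edgeSet.ncard = n + C.card := by
  classical
  obtain ⟨v, p, hp, hlen⟩ := hG n hn (by simp)
  obtain ⟨f, hmod, hinj, hadj⟩ := exists_periodic hp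
  rw [hlen] at hmod hinj
  have hper : ∀ {i j}, i ≡ j [MOD n] → f i = f j := fun {i j} h => by
    rw [← hmod i, ← hmod j]
    exact congrArg f h
  set H := Set.range fun x => s(f x, f (x + 1)) with hH
  let busy : ℕ → Prop := fun y => ∃ w, G.Adj (f y) w ∧ s(f y, w) ∉ H
  let free : ℕ → Prop := fun d => ∃ s, ∀ y, s < y → y < s + d → ¬ busy y
  -- The greatest number of consecutive edges of the Hamiltonian cycle with no chord end strictly
  -- inside. The rotation by t moves the far end of such a stretch to the label 0.
  set D := Nat.findGreatest free n with hD
  obtain ⟨s₀, hs₀⟩ : free D := Nat.findGreatest_spec (Nat.zero_le n) ⟨0, fun y _ _ => by omega⟩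
  set t := s₀ + D with ht
  let g : ℕ → Fin n := fun i => f (i + t)
  have hring : IsRing n g := by
    refine ⟨hn, fun i hi j hj he => ?_, hper ?_⟩
    · have h1 : f ((i + t) % n) = f ((j + t) % n) := by rw [hmod, hmod]; exact he
      have h2 : i + t ≡ j + t [MOD n] :=
        hinj _ (Nat.mod_lt _ (by omega)) _ (Nat.mod_lt _ (by omega)) h1
      exact (h2.add_right_cancel' t).eq_of_lt_of_lt hi hj
    · rw [zero_add, add_comm]
      exact Nat.add_modulus_modEq_iff.2 rfl
  have hedge : ∀ i, s(g i, g (i + 1)) ∈ H := fun i => ⟨i + t, by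
    simp only [g, show i + 1 + t = i + t + 1 by omega]⟩
  have hgadj : ∀ i, G.Adj (g i) (g (i + 1)) := fun i => by
    have := hadj (i + t)
    rwa [show i + t + 1 = i + 1 + t by omega] at this
  have hsurj : ∀ w, ∃ i < n, g i = w := by
    have h1 : Function.Injective fun i : Fin n => g i := fun i j he =>
      Fin.ext (hring.inj i i.2 j j.2 he)
    intro w
    obtain ⟨i, hi⟩ := Finite.injective_iff_surjective.1 h1 w
    exact ⟨i, i.2, hi⟩
  set C := (range n ×ˢ range n).filter fun c =>
    c.1 < c.2 ∧ G.Adj (g c.1) (g c.2) ∧ s(g c.1, g c.2) ∉ H with hCdef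
  have hmemC : ∀ c, c ∈ C ↔ (c.1 < c.2 ∧ c.2 < n) ∧ G.Adj (g c.1) (g c.2) ∧
      s(g c.1, g c.2) ∉ H := by
    intro c
    rw [hCdef, mem_filter, mem_product, mem_range, mem_range]
    constructor
    · rintro ⟨⟨_, h2⟩, h3, h4⟩
      exact ⟨⟨h3, h2⟩, h4⟩
    · rintro ⟨⟨h1, h2⟩, h4⟩
      exact ⟨⟨by omega, h2⟩, h1, h4⟩
  have hchords : IsChords n g C := fun c hc => by
    obtain ⟨h1, _, h3⟩ := (hmemC c).1 hc
    exact ⟨h1, fun x _ he => h3 (he ▸ hedge x)⟩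
  have hends : ∀ a b, a < n → b < n → G.Adj (g a) (g b) → s(g a, g b) ∉ H →
      ∃ c ∈ C, s(g c.1, g c.2) = s(g a, g b) ∧ (c.1 = a ∨ c.2 = a) := by
    intro a b ha hb h1 h2
    rcases lt_trichotomy a b with hlt | rfl | hlt
    · exact ⟨(a, b), (hmemC _).2 ⟨⟨hlt, hb⟩, h1, h2⟩, rfl, Or.inl rfl⟩
    · exact absurd h1 (G.loopless.irrefl _)
    · exact ⟨(b, a), (hmemC _).2 ⟨⟨hlt, ha⟩, h1.symm, by rwa [Sym2.eq_swap]⟩, Sym2.eq_swap,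
        Or.inr rfl⟩
  have hcases : ∀ e ∈ G.edgeSet, (∃ c ∈ C, s(g c.1, g c.2) = e) ∨
      ∃ x < n, s(g x, g (x + 1)) = e := by
    intro e he
    by_cases heH : e ∈ H
    · right
      obtain ⟨x, rfl⟩ := heH
      obtain ⟨y, hy, hyx⟩ := exists_lt_modEq (show 0 < n by omega) t x
      refine ⟨y, hy, ?_⟩
      simp only [g]
      rw [hper hyx, show y + 1 + t = y + t + 1 by omega, hper (hyx.add_right 1)]
    · left
      induction e with | _ a b =>
      obtain ⟨i, hi, rfl⟩ := hsurj a
      obtain ⟨j, hj, rfl⟩ := hsurj b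
      obtain ⟨c, hc, h1, _⟩ := hends i j hi hj he heH
      exact ⟨c, hc, h1⟩
  have hrep : ∀ F : Finset (Sym2 (Fin n)), (∀ e ∈ F, e ∈ G.edgeSet) →
      edgesOf n g (C.filter fun c => s(g c.1, g c.2) ∈ F)
        (fun x => decide (s(g x, g (x + 1)) ∈ F)) = F := by
    intro F hF
    ext e
    rw [edgesOf, mem_union, mem_image, mem_image]
    constructor
    · rintro (⟨c, hc, rfl⟩ | ⟨x, hx, rfl⟩)
      · exact (mem_filter.1 hc).2
      · exact of_decide_eq_true (mem_filter.1 hx).2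
    · intro he
      rcases hcases e (hF e he) with ⟨c, hc, rfl⟩ | ⟨x, hx, rfl⟩
      · exact Or.inl ⟨c, mem_filter.2 ⟨hc, he⟩, rfl⟩
      · exact Or.inr ⟨x, mem_filter.2 ⟨mem_range.2 hx, decide_eq_true he⟩, rfl⟩
  refine ⟨C, ⟨fun c hc => ((hmemC c).1 hc).1, ?_, ?_⟩, ?_⟩
  · intro s d hsd hfree y hyd hyn
    have hdD : d ≤ D := by
      refine Nat.le_findGreatest (by omega) ⟨s + t, fun z hz1 hz2 => ?_⟩
      rintro ⟨w, hw1, hw2⟩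
      obtain ⟨j, hj, rfl⟩ := hsurj w
      have hz : f z = g (z - t) := by simp only [g, Nat.sub_add_cancel (show t ≤ z by omega)]
      rw [hz] at hw1 hw2
      obtain ⟨c, hc, _, hcz⟩ := hends (z - t) j (by omega) hj hw1 hw2
      have := hfree (z - t) (by omega) (by omega) c hc
      tauto
    -- In the old labelling y becomes y + t - n, which is strictly between s₀ and s₀ + D because d ≤
    -- D.
    have hy : ¬ busy (y + t - n) := hs₀ _ (by omega) (by omega)
    have hgy : f (y + t - n) = g y := by
      refine hper ?_
      have h1 : y + t - n + n ≡ y + t - n [MOD n] := Nat.add_modulus_modEq_iff.2 rfl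
      rw [Nat.sub_add_cancel (by omega)] at h1
      exact h1.symm
    intro c hc
    obtain ⟨_, h1, h2⟩ := (hmemC c).1 hc
    refine ⟨fun he => hy ⟨g c.2, ?_⟩, fun he => hy ⟨g c.1, ?_⟩⟩
    · rw [hgy, ← he]
      exact ⟨h1, h2⟩
    · rw [hgy, ← he, Sym2.eq_swap]
      exact ⟨h1.symm, h2⟩
  · intro len h3 hlt
    obtain ⟨u, q, hq, rfl⟩ := hG len h3 (by simpa using hlt.le)
    have hqring := isRing_getVert hq
    set F := q.edges.toFinset with hF
    have hFG : ∀ e ∈ F, e ∈ G.edgeSet := fun e he =>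
      q.edges_subset_edgeSet (List.mem_toFinset.1 he)
    have hFcard : F.card = q.length := by
      rw [hF, List.toFinset_card_of_nodup hq.edges_nodup, q.length_edges]
    set S := C.filter fun c => s(g c.1, g c.2) ∈ F with hS
    set X : ℕ → Bool := fun x => decide (s(g x, g (x + 1)) ∈ F) with hX
    have hSX : edgesOf n g S X = F := hrep F hFG
    have hSC : S ⊆ C := filter_subset _ _
    have hcard : S.card + ((range n).filter fun x => X x = true).card = q.length := by
      rw [← hring.card_edgesOf (hchords.mono hSC), hSX, hFcard]
    have hdeg : ∀ v < n, degree n S X v = 0 ∨ degree n S X v = 2 := by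
      intro v hv
      rw [← hring.card_incident (hchords.mono hSC) X hv, hSX, hF, edges_toFinset_eq]
      exact hqring.card_incident_eq _
    refine ⟨S, hSC, ?_, X, hcard, hdeg, ?_⟩
    -- Without chords the edge set is empty or the whole Hamiltonian cycle, which contradicts 3 ≤
    -- len < n.
    · rw [nonempty_iff_ne_empty]
      intro hempty
      rw [hempty] at hdeg hcard
      have hconst : ∀ x < n, X x = X (n - 1) := fun x hx => eq_last_of_even (fun v hv => by
        rcases hdeg v hv with h0 | h0 <;> rw [h0] <;> decide) hx
      cases hb : X (n - 1) with
      | false =>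
        rw [filter_false_of_mem fun x hx => by
          rw [hconst x (mem_range.1 hx), hb]; decide, card_empty, card_empty] at hcard
        omega
      | true =>
        rw [filter_true_of_mem fun x hx => by
          rw [hconst x (mem_range.1 hx), hb], card_empty, card_range] at hcard
        omega
    · intro T hTS hTne hne Y hY
      by_contra hcon
      push Not at hcon
      -- Otherwise the even set given by T and Y lies inside the cycle q, hence is all of it, and
      -- then T = S.
      have hsub : edgesOf n g T Y ⊆ F := by
        rw [← hSX, edgesOf, edgesOf]
        refine union_subset_union (image_subset_image hTS) (image_subset_image fun x hx => ?_)
        obtain ⟨h1, h2⟩ := mem_filter.1 hx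
        exact mem_filter.2 ⟨h1, by simpa using hcon x (mem_range.1 h1) h2⟩
      have hTF : edgesOf n g T Y = F := by
        rw [hF, edges_toFinset_eq] at hsub ⊢
        refine hqring.eq_of_even hsub ?_ fun u => ?_
        · exact (hTne.image _).mono subset_union_left
        · obtain ⟨i, hi, rfl⟩ := hsurj u
          rw [hring.card_incident (hchords.mono (hTS.trans hSC)) Y hi]
          exact hY i hi
      refine hne (Subset.antisymm hTS fun c hc => ?_)
      have h1 : s(g c.1, g c.2) ∈ edgesOf n g T Y := by
        rw [hTF]
        exact (mem_filter.1 hc).2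
      rw [edgesOf, mem_union, mem_image, mem_image] at h1
      rcases h1 with ⟨c', hc', he⟩ | ⟨x, hx, he⟩
      · rwa [← hring.chord_injOn hchords (hSC (hTS hc')) (hSC hc) he]
      · exact absurd he.symm ((hchords c (hSC hc)).2 x (mem_range.1 (mem_filter.1 hx).1))
  · have hE : G.edgeSet = ↑(edgesOf n g C fun _ => true) := by
      ext e
      rw [mem_coe, edgesOf, mem_union, mem_image, mem_image]
      constructor
      · intro he
        rcases hcases e he with hc | ⟨x, hx, he⟩
        · exact Or.inl hc
        · exact Or.inr ⟨x, mem_filter.2 ⟨mem_range.2 hx, rfl⟩, he⟩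
      · rintro (⟨c, hc, rfl⟩ | ⟨x, _, rfl⟩)
        · exact ((hmemC c).1 hc).2.1
        · exact hgadj x
    rw [hE, Set.ncard_coe_finset, hring.card_edgesOf hchords, filter_true_of_mem fun _ _ => rfl, card_range,
      add_comm]

end Graph


/-! ### A cycle with given chords -/

section ChordGraph

/-- The cycle `0, …, n - 1` with the chords in `L`. -/
def chordGraph (n : ℕ) (L : List (ℕ × ℕ)) : SimpleGraph (Fin n) :=
  SimpleGraph.fromRel fun u v => (v : ℕ) = ((u : ℕ) + 1) % n ∨ ((u : ℕ), (v : ℕ)) ∈ L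

/-- The pairs in `L` are distinct chords of the cycle `0, …, n - 1`. -/
def validChords (n : ℕ) (L : List (ℕ × ℕ)) : Prop :=
  3 ≤ n ∧ L.Nodup ∧ ∀ c ∈ L, c.1 + 1 < c.2 ∧ c.2 < n ∧ (c.1 = 0 → c.2 + 1 < n)

instance (n : ℕ) (L : List (ℕ × ℕ)) : Decidable (validChords n L) := by
  unfold validChords
  infer_instance

variable {n : ℕ} {L : List (ℕ × ℕ)}

theorem ncard_edgeSet_chordGraph (h : validChords n L) :
    (chordGraph n L).edgeSet.ncard = n + L.length := by
  obtain ⟨h3, hnd, hL⟩ := h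
  have hn : 0 < n := by omega
  let f : ℕ → Fin n := fun i => ⟨i % n, Nat.mod_lt i hn⟩
  have hf : ∀ u : Fin n, f u = u := fun u => Fin.ext (Nat.mod_eq_of_lt u.2)
  have hval : ∀ i < n, (f i : ℕ) = i := fun i hi => Nat.mod_eq_of_lt hi
  have hring : IsRing n f := by
    refine ⟨h3, fun i hi j hj he => ?_, Fin.ext ?_⟩
    · rw [← hval i hi, ← hval j hj, he]
    · simp [f]
  have hchords : IsChords n f L.toFinset := by
    intro c hc
    have h1 := hL c (List.mem_toFinset.1 hc)
    refine ⟨by omega, fun x hx he => ?_⟩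
    have m1 : f c.1 ∈ s(f x, f (x + 1)) := he ▸ Sym2.mem_mk_left _ _
    have m2 : f c.2 ∈ s(f x, f (x + 1)) := he ▸ Sym2.mem_mk_right _ _
    rw [hring.apply_mem (by omega) hx] at m1 m2
    unfold prev at m1 m2
    split_ifs at m1 m2 <;> omega
  have hadj : ∀ u v : Fin n, (v : ℕ) = ((u : ℕ) + 1) % n →
      s(u, v) = s(f u, f (u + 1)) := fun u v he => by
    rw [hf, show f (u + 1) = v from Fin.ext he.symm]
  have hE : (chordGraph n L).edgeSet = ↑(edgesOf n f L.toFinset fun _ => true) := by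
    ext e
    induction e with | _ a b =>
    rw [SimpleGraph.mem_edgeSet, chordGraph, SimpleGraph.fromRel_adj, mem_coe, edgesOf, mem_union,
      mem_image, mem_image]
    constructor
    · rintro ⟨_, (h1 | h1) | (h1 | h1)⟩
      · exact Or.inr ⟨a, mem_filter.2 ⟨mem_range.2 a.2, rfl⟩, (hadj a b h1).symm⟩
      · exact Or.inl ⟨_, List.mem_toFinset.2 h1, by simp only [hf]⟩
      · exact Or.inr ⟨b, mem_filter.2 ⟨mem_range.2 b.2, rfl⟩, by
          rw [Sym2.eq_swap (a := a), hadj b a h1]⟩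
      · exact Or.inl ⟨_, List.mem_toFinset.2 h1, by simp only [hf]; exact Sym2.eq_swap⟩
    · have hcon : ∀ u v : Fin n, u ≠ v → ((v : ℕ) = ((u : ℕ) + 1) % n ∨ ((u : ℕ), (v : ℕ)) ∈ L) →
          s(u, v) = s(a, b) → a ≠ b ∧ (((b : ℕ) = ((a : ℕ) + 1) % n ∨ ((a : ℕ), (b : ℕ)) ∈ L) ∨
            ((a : ℕ) = ((b : ℕ) + 1) % n ∨ ((b : ℕ), (a : ℕ)) ∈ L)) := by
        intro u v hne hr he
        rcases Sym2.eq_iff.1 he with ⟨rfl, rfl⟩ | ⟨rfl, rfl⟩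
        · exact ⟨hne, Or.inl hr⟩
        · exact ⟨hne.symm, Or.inr hr⟩
      rintro (⟨c, hc, he⟩ | ⟨x, hx, he⟩)
      · have hc := List.mem_toFinset.1 hc
        have h1 := hL c hc
        have v1 := hval c.1 (by omega)
        have v2 := hval c.2 (by omega)
        refine hcon _ _ (fun h => ?_) (Or.inr ?_) he
        · have := congrArg Fin.val h
          omega
        · rw [v1, v2]
          exact hc
      · have hx := mem_range.1 (mem_filter.1 hx).1
        refine hcon _ _ (fun h => ?_) (Or.inl ?_) he
        · exact prev_ne h3 ((hring.apply_eq_apply_succ hx hx).1 h).symm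
        · rw [hval x hx]
  rw [hE, Set.ncard_coe_finset, hring.card_edgesOf hchords, filter_true_of_mem fun _ _ => rfl,
    card_range, List.toFinset_card_of_nodup hnd, add_comm]

/-- The neighbours of `u` in the cycle `0, …, n - 1` with the chords in `L`. -/
def neighbours (n : ℕ) (L : List (ℕ × ℕ)) (u : ℕ) : List ℕ :=
  Nat.mod (Nat.succ u) n :: Nat.mod (Nat.add u (Nat.pred n)) n :: L.foldr (fun c l =>
    bif Nat.beq c.1 u then c.2 :: l else bif Nat.beq c.2 u then c.1 :: l else l) []

theorem mem_foldr_chords {u w : ℕ} (hw : w ∈ L.foldr (fun c l =>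
    bif Nat.beq c.1 u then c.2 :: l else bif Nat.beq c.2 u then c.1 :: l else l) []) :
    (u, w) ∈ L ∨ (w, u) ∈ L := by
  induction L with
  | nil => exact absurd hw List.not_mem_nil
  | cons c l ih =>
    rw [List.foldr_cons] at hw
    have hrec : w ∈ l.foldr (fun c l =>
        bif Nat.beq c.1 u then c.2 :: l else bif Nat.beq c.2 u then c.1 :: l else l) [] →
        (u, w) ∈ c :: l ∨ (w, u) ∈ c :: l := fun h =>
      (ih h).imp (List.mem_cons_of_mem _) (List.mem_cons_of_mem _)
    cases h1 : Nat.beq c.1 u with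
    | true =>
      rw [h1, cond_true, List.mem_cons] at hw
      rcases hw with rfl | hw
      · rw [← Nat.eq_of_beq_eq_true h1]
        exact Or.inl List.mem_cons_self
      · exact hrec hw
    | false =>
      rw [h1, cond_false] at hw
      cases h2 : Nat.beq c.2 u with
      | true =>
        rw [h2, cond_true, List.mem_cons] at hw
        rcases hw with rfl | hw
        · rw [← Nat.eq_of_beq_eq_true h2]
          exact Or.inr List.mem_cons_self
        · exact hrec hw
      | false =>
        rw [h2, cond_false] at hw
        exact hrec hw

theorem adj_of_mem_neighbours (h : validChords n L) {u : Fin n} {w : ℕ}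
    (hw : w ∈ neighbours n L u) : ∃ hwn : w < n, (chordGraph n L).Adj u ⟨w, hwn⟩ := by
  obtain ⟨h3, _, hL⟩ := h
  have hu := u.2
  have key : ∀ hwn : w < n, (u : ℕ) ≠ w → (w = ((u : ℕ) + 1) % n ∨ ((u : ℕ), w) ∈ L) ∨
      ((u : ℕ) = (w + 1) % n ∨ (w, (u : ℕ)) ∈ L) → (chordGraph n L).Adj u ⟨w, hwn⟩ := by
    intro hwn hne hr
    rw [chordGraph, SimpleGraph.fromRel_adj]
    exact ⟨fun he => hne (congrArg Fin.val he), hr⟩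
  rw [neighbours, List.mem_cons, List.mem_cons] at hw
  rcases hw with hw | hw | hw
  · have he : w = ((u : ℕ) + 1) % n := hw
    have hwn : w < n := he ▸ Nat.mod_lt _ (by omega)
    refine ⟨hwn, key hwn ?_ (Or.inl (Or.inl he))⟩
    rcases Nat.lt_or_ge ((u : ℕ) + 1) n with hlt | hge
    · rw [Nat.mod_eq_of_lt hlt] at he
      omega
    · rw [show (u : ℕ) + 1 = n by omega, Nat.mod_self] at he
      omega
  · have he : w = ((u : ℕ) + (n - 1)) % n := hw
    have hwn : w < n := he ▸ Nat.mod_lt _ (by omega)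
    have hval : ((u : ℕ) = 0 ∧ w = n - 1) ∨ (0 < (u : ℕ) ∧ w = u - 1) := by
      rcases Nat.eq_zero_or_pos (u : ℕ) with h0 | h0
      · rw [h0, zero_add, Nat.mod_eq_of_lt (by omega)] at he
        exact Or.inl ⟨h0, he⟩
      · rw [show (u : ℕ) + (n - 1) = (u - 1) + n by omega, Nat.add_mod_right,
          Nat.mod_eq_of_lt (by omega)] at he
        exact Or.inr ⟨h0, he⟩
    refine ⟨hwn, key hwn (by omega) (Or.inr (Or.inl ?_))⟩
    rcases hval with ⟨h0, h1⟩ | ⟨h0, h1⟩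
    · rw [h1, Nat.sub_add_cancel (by omega), Nat.mod_self, h0]
    · rw [h1, Nat.sub_add_cancel h0, Nat.mod_eq_of_lt hu]
  · rcases mem_foldr_chords hw with hw | hw <;> have h1 := hL _ hw
    · exact ⟨h1.2.1, key _ (by dsimp only at h1; omega) (Or.inl (Or.inr hw))⟩
    · have hwn : w < n := by dsimp only at h1; omega
      exact ⟨hwn, key _ (by dsimp only at h1; omega) (Or.inr (Or.inr hw))⟩

/-- The set of lengths of paths from `u` to `s` with inner vertices outside `vis`, as a bitmask. -/
def lengths (nb : ℕ → List ℕ) (s : ℕ) : ℕ → ℕ → ℕ → ℕ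
  | 0 => fun _ _ => 0
  | k + 1 => fun vis u => (nb u).foldr (fun w acc => Nat.lor
      (bif Nat.beq w s then 2 else bif Nat.beq (Nat.land (Nat.shiftRight vis w) 1) 1 then 0 else
        Nat.mul 2 (lengths nb s k (Nat.lor vis (Nat.shiftLeft 1 w)) w)) acc) 0

/-- The cycles through the vertices in `starts` have all lengths from `3` to `n`. -/
def allLengths (n : ℕ) (L : List (ℕ × ℕ)) (starts : List ℕ) : Bool :=
  Nat.beq (Nat.land (starts.foldr (fun s acc =>
      Nat.lor (lengths (neighbours n L) s n (Nat.shiftLeft 1 s) s) acc) 0)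
    ((2 ^ (n - 2) - 1) <<< 3)) ((2 ^ (n - 2) - 1) <<< 3)

theorem exists_of_testBit_foldr_lor {α : Type*} {l : List α} {F : α → ℕ} {i : ℕ}
    (h : (l.foldr (fun a acc => Nat.lor (F a) acc) 0).testBit i = true) :
    ∃ a ∈ l, (F a).testBit i = true := by
  induction l with
  | nil => simp at h
  | cons a l ih =>
    rw [List.foldr_cons] at h
    change (F a ||| _).testBit i = true at h
    rw [Nat.testBit_or, Bool.or_eq_true] at h
    rcases h with h | h
    · exact ⟨a, List.mem_cons_self, h⟩
    · obtain ⟨b, hb, hb'⟩ := ih h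
      exact ⟨b, List.mem_cons_of_mem _ hb, hb'⟩

theorem testBit_eq_beq (m w : ℕ) :
    m.testBit w = Nat.beq (Nat.land (Nat.shiftRight m w) 1) 1 := by
  rw [Bool.eq_iff_iff, Nat.beq_eq]
  change _ ↔ (m >>> w &&& 1) = 1
  rw [Nat.testBit, Nat.and_comm, Nat.and_one_is_mod]
  rcases Nat.mod_two_eq_zero_or_one (m >>> w) with h | h <;> rw [h] <;> decide

theorem exists_step_of_testBit_lengths {nb : ℕ → List ℕ} {s k vis u ℓ : ℕ}
    (h : (lengths nb s (k + 1) vis u).testBit ℓ = true) :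
    ∃ w ∈ nb u, (w = s ∧ ℓ = 1) ∨ (w ≠ s ∧ vis.testBit w = false ∧ ∃ m, ℓ = m + 1 ∧
      (lengths nb s k (vis ||| 1 <<< w) w).testBit m = true) := by
  rw [lengths] at h
  obtain ⟨w, hw, hb⟩ := exists_of_testBit_foldr_lor h
  refine ⟨w, hw, ?_⟩
  rw [← testBit_eq_beq] at hb
  cases h1 : Nat.beq w s with
  | true =>
    rw [h1, cond_true, show (2 : ℕ) = 2 ^ 1 from rfl, Nat.testBit_two_pow, decide_eq_true_eq] at hb
    exact Or.inl ⟨Nat.eq_of_beq_eq_true h1, hb.symm⟩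
  | false =>
    rw [h1, cond_false] at hb
    cases h2 : vis.testBit w with
    | true =>
      rw [h2, cond_true, Nat.zero_testBit] at hb
      exact absurd hb Bool.false_ne_true
    | false =>
      rw [h2, cond_false] at hb
      change (2 * lengths nb s k (vis ||| 1 <<< w) w).testBit ℓ = true at hb
      refine Or.inr ⟨Nat.ne_of_beq_eq_false h1, rfl, ?_⟩
      cases ℓ with
      | zero => simp at hb
      | succ m =>
        rw [Nat.testBit_succ, Nat.mul_div_cancel_left _ (by decide)] at hb
        exact ⟨m, rfl, hb⟩

/-- The mask vis contains u and the vertices visited earlier. The path found from the next vertex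
avoids them up to its endpoint s, so it remains a path when u is prepended. -/
theorem exists_path_of_testBit_lengths (h : validChords n L) {s : Fin n} :
    ∀ (k vis ℓ : ℕ) (u : Fin n), u ≠ s → vis.testBit u = true →
      (lengths (neighbours n L) s k vis u).testBit ℓ = true →
      ∃ p : (chordGraph n L).Walk u s, p.IsPath ∧ p.length = ℓ ∧
        ∀ x ∈ p.support, x ≠ u → x ≠ s → vis.testBit x = false := by
  intro k
  induction k with
  | zero =>
    intro vis ℓ u _ _ hb
    rw [lengths, Nat.zero_testBit] at hb
    exact absurd hb Bool.false_ne_true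
  | succ k ih =>
    intro vis ℓ u hus hvis hb
    obtain ⟨w, hw, hcase⟩ := exists_step_of_testBit_lengths hb
    obtain ⟨hwn, hadj⟩ := adj_of_mem_neighbours h hw
    rcases hcase with ⟨rfl, rfl⟩ | ⟨hws, hwv, m, rfl, hm⟩
    · refine ⟨SimpleGraph.Walk.cons hadj SimpleGraph.Walk.nil, ?_, rfl, ?_⟩
      · rw [SimpleGraph.Walk.cons_isPath_iff]
        exact ⟨SimpleGraph.Walk.IsPath.nil, by simpa using hus⟩
      · intro x hx h1 h2
        simp only [SimpleGraph.Walk.support_cons, SimpleGraph.Walk.support_nil, List.mem_cons,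
          List.not_mem_nil, or_false] at hx
        tauto
    · have hbit : ∀ x : ℕ, (vis ||| 1 <<< w).testBit x = (vis.testBit x || decide (w = x)) := by
        intro x
        rw [Nat.testBit_or, Nat.one_shiftLeft, Nat.testBit_two_pow]
      obtain ⟨p, hp, hpl, hps⟩ := ih (vis ||| 1 <<< w) m ⟨w, hwn⟩
        (fun he => hws (congrArg Fin.val he)) (by rw [hbit]; simp) hm
      have hout : ∀ x ∈ p.support, x ≠ s → vis.testBit x = false := by
        intro x hx hxs
        by_cases hxw : x = ⟨w, hwn⟩
        · rw [hxw]
          exact hwv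
        · have := hps x hx hxw hxs
          rw [hbit, Bool.or_eq_false_iff] at this
          exact this.1
      refine ⟨SimpleGraph.Walk.cons hadj p, ?_, by rw [SimpleGraph.Walk.length_cons, hpl], ?_⟩
      · rw [SimpleGraph.Walk.cons_isPath_iff]
        refine ⟨hp, fun hu => ?_⟩
        rw [hout u hu hus] at hvis
        exact Bool.false_ne_true hvis
      · intro x hx h1 h2
        rw [SimpleGraph.Walk.support_cons, List.mem_cons] at hx
        exact hout x (hx.resolve_left h1) h2

/-- The search also reports the length 2 of going to a neighbour and back; from 3 on, the first edge
and the path back form a cycle. -/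
theorem exists_cycle_of_testBit_lengths (h : validChords n L) {s : Fin n} {k ℓ : ℕ} (hℓ : 3 ≤ ℓ)
    (hb : (lengths (neighbours n L) s k (1 <<< (s : ℕ)) s).testBit ℓ = true) :
    ∃ p : (chordGraph n L).Walk s s, p.IsCycle ∧ p.length = ℓ := by
  cases k with
  | zero =>
    rw [lengths, Nat.zero_testBit] at hb
    exact absurd hb Bool.false_ne_true
  | succ k =>
    obtain ⟨w, hw, hcase⟩ := exists_step_of_testBit_lengths hb
    obtain ⟨hwn, hadj⟩ := adj_of_mem_neighbours h hw
    rcases hcase with ⟨_, rfl⟩ | ⟨hws, _, m, rfl, hm⟩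
    · omega
    · obtain ⟨p, hp, hpl, _⟩ := exists_path_of_testBit_lengths h k _ m ⟨w, hwn⟩
        (fun he => hws (congrArg Fin.val he))
        (by rw [Nat.testBit_or, Nat.one_shiftLeft (n := w), Nat.testBit_two_pow]; simp) hm
      have hlen : (SimpleGraph.Walk.cons hadj p).length = m + 1 := by
        rw [SimpleGraph.Walk.length_cons, hpl]
      refine ⟨SimpleGraph.Walk.cons hadj p, ?_, hlen⟩
      rw [SimpleGraph.Walk.isCycle_iff_isPath_tail_and_le_length]
      exact ⟨by simpa using hp, by omega⟩

theorem isPancyclic_chordGraph (h : validChords n L) {starts : List ℕ}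
    (hs : ∀ s ∈ starts, s < n) (hall : allLengths n L starts = true) :
    IsPancyclic (chordGraph n L) := by
  intro ℓ h3 hℓ
  rw [Fintype.card_fin] at hℓ
  have heq := Nat.eq_of_beq_eq_true hall
  have hbit := congrArg (fun m => m.testBit ℓ) heq
  change (_ &&& _ : ℕ).testBit ℓ = _ at hbit
  rw [Nat.testBit_and, Nat.testBit_shiftLeft, Nat.testBit_two_pow_sub_one] at hbit
  rw [decide_eq_true (show ℓ ≥ 3 from h3), decide_eq_true (show ℓ - 3 < n - 2 by omega), Bool.and_true,
    Bool.and_true] at hbit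
  obtain ⟨s, hs', hb⟩ := exists_of_testBit_foldr_lor hbit
  obtain ⟨p, hp⟩ := exists_cycle_of_testBit_lengths h (s := ⟨s, hs s hs'⟩) h3 hb
  exact ⟨_, p, hp⟩

end ChordGraph


/-! ### The lower bound -/

section LowerBound

set_option maxRecDepth 100000

/-- Two candidates cannot supply three lengths, so this is pure counting. -/
theorem not_feasible_one : (matchings 1 (List.range 2)).any
    (feasible 2 ((List.range 2).map fun i => 256 ^ i) (List.range 1)
      (List.range' 6 32)) = false := by
  decide +kernel

/-- With six candidates, only n = 9 survives counting, with no slack. -/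
theorem not_feasible_two : (matchings 2 (List.range 4)).any
    (feasible 4 ((List.range 4).map fun i => 256 ^ i) (List.range 3)
      (List.range' 9 29)) = false := by
  decide +kernel

/-- With fourteen candidates, counting leaves n = 15, 16, 17, with slack at most 2. -/
theorem not_feasible_three : (matchings 3 (List.range 6)).any
    (feasible 6 ((List.range 6).map fun i => 256 ^ i) (List.range 5)
      (List.range' 15 23)) = false := by
  decide +kernel

/-- Up to thirty candidates for 22 lengths leave slack up to 8, more than for any larger n. The 105
matchings are split into two batches for this n. -/
theorem not_feasible_four_take : ((matchings 4 (List.range 8)).take 40).any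
    (feasible 8 ((List.range 8).map fun i => 256 ^ i) (List.range 7) [25]) = false := by
  decide +kernel

theorem not_feasible_four_drop : ((matchings 4 (List.range 8)).drop 40).any
    (feasible 8 ((List.range 8).map fun i => 256 ^ i) (List.range 7) [25]) = false := by
  decide +kernel

theorem not_feasible_four_next : (matchings 4 (List.range 8)).any
    (feasible 8 ((List.range 8).map fun i => 256 ^ i) (List.range 7) [26]) = false := by
  decide +kernel

theorem not_feasible_four_rest : (matchings 4 (List.range 8)).any
    (feasible 8 ((List.range 8).map fun i => 256 ^ i) (List.range 7)
      (List.range' 27 11)) = false := by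
  decide +kernel

end LowerBound

theorem ChordSystem.any_feasible {n k : ℕ} {C : Finset (ℕ × ℕ)} (h : ChordSystem n C)
    (hk : C.card = k) (hpos : 0 < k) (hk255 : 2 * k < 255) (hn255 : n < 255) {ns : List ℕ}
    (hns : n ∈ ns) : (matchings k (List.range (2 * k))).any
      (feasible (2 * k) ((List.range (2 * k)).map fun i => 256 ^ i) (List.range (2 * k - 1)) ns) =
        true := by
  subst hk
  exact List.any_eq_true.2 (h.exists_feasible hpos hk255 hn255 hns)

theorem not_feasible_four_first : (matchings 4 (List.range 8)).any
    (feasible 8 ((List.range 8).map fun i => 256 ^ i) (List.range 7) [25]) = false := by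
  rw [← List.take_append_drop 40 (matchings 4 (List.range 8)), List.any_append,
    not_feasible_four_take, not_feasible_four_drop, Bool.or_false]

/-- A chord system with few chords has few vertices. -/
theorem ChordSystem.le_card {n : ℕ} {C : Finset (ℕ × ℕ)} (h : ChordSystem n C) (hn : n ≤ 37) :
    (4 ≤ n → 1 ≤ C.card) ∧ (6 ≤ n → 2 ≤ C.card) ∧ (9 ≤ n → 3 ≤ C.card) ∧
      (15 ≤ n → 4 ≤ C.card) ∧ (25 ≤ n → 5 ≤ C.card) := by
  have h0 : C.card = 0 → n < 4 := by
    intro h0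
    by_contra hlt
    obtain ⟨S, hS, hne, _⟩ := h.cover 3 le_rfl (by omega)
    have := card_le_card hS
    have := hne.card_pos
    omega
  have h1 : C.card = 1 → n < 6 := by
    intro hC
    by_contra hlt
    have := h.any_feasible hC (by decide) (by decide) (by omega)
      (ns := List.range' 6 32) (List.mem_range'_1.2 (by omega))
    exact absurd (not_feasible_one.symm.trans this) Bool.false_ne_true
  have h2 : C.card = 2 → n < 9 := by
    intro hC
    by_contra hlt
    have := h.any_feasible hC (by decide) (by decide) (by omega)
      (ns := List.range' 9 29) (List.mem_range'_1.2 (by omega))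
    exact absurd (not_feasible_two.symm.trans this) Bool.false_ne_true
  have h3 : C.card = 3 → n < 15 := by
    intro hC
    by_contra hlt
    have := h.any_feasible hC (by decide) (by decide) (by omega)
      (ns := List.range' 15 23) (List.mem_range'_1.2 (by omega))
    exact absurd (not_feasible_three.symm.trans this) Bool.false_ne_true
  have h4 : C.card = 4 → n < 25 := by
    intro hC
    by_contra hlt
    rcases (show n = 25 ∨ n = 26 ∨ 27 ≤ n by omega) with hn' | hn' | hn'
    · have := h.any_feasible hC (by decide) (by decide) (by omega)
        (ns := [25]) (List.mem_singleton.2 hn')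
      exact absurd (not_feasible_four_first.symm.trans this) Bool.false_ne_true
    · have := h.any_feasible hC (by decide) (by decide) (by omega)
        (ns := [26]) (List.mem_singleton.2 hn')
      exact absurd (not_feasible_four_next.symm.trans this) Bool.false_ne_true
    · have := h.any_feasible hC (by decide) (by decide) (by omega)
        (ns := List.range' 27 11) (List.mem_range'_1.2 (by omega))
      exact absurd (not_feasible_four_rest.symm.trans this) Bool.false_ne_true
  omega

theorem le_ncard_edgeSet {n k : ℕ} {G : SimpleGraph (Fin n)} (hG : IsPancyclic G) (h3 : 3 ≤ n)
    (hn : n ≤ 37) (hk : (k = 0) ∨ (k = 1 ∧ 4 ≤ n) ∨ (k = 2 ∧ 6 ≤ n) ∨ (k = 3 ∧ 9 ≤ n) ∨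
      (k = 4 ∧ 15 ≤ n) ∨ (k = 5 ∧ 25 ≤ n)) : n + k ≤ G.edgeSet.ncard := by
  obtain ⟨C, hC, hcard⟩ := exists_chordSystem h3 hG
  have := hC.le_card hn
  omega

theorem minPancyclicEdges_eq {n k : ℕ} {L : List (ℕ × ℕ)} {starts : List ℕ}
    (hL : validChords n L) (hlen : L.length = k) (hs : ∀ s ∈ starts, s < n)
    (hall : allLengths n L starts = true) (hn : n ≤ 37)
    (hk : (k = 0) ∨ (k = 1 ∧ 4 ≤ n) ∨ (k = 2 ∧ 6 ≤ n) ∨ (k = 3 ∧ 9 ≤ n) ∨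
      (k = 4 ∧ 15 ≤ n) ∨ (k = 5 ∧ 25 ≤ n)) : minPancyclicEdges n = n + k := by
  have hmem : n + k ∈ {e : ℕ | ∃ G : SimpleGraph (Fin n), IsPancyclic G ∧ G.edgeSet.ncard = e} :=
    ⟨chordGraph n L, isPancyclic_chordGraph hL hs hall, by
      rw [ncard_edgeSet_chordGraph hL, hlen]⟩
  refine le_antisymm (Nat.sInf_le hmem) ?_
  obtain ⟨G, hG, he⟩ := Nat.sInf_mem ⟨_, hmem⟩
  have := le_ncard_edgeSet hG hL.1 hn hk
  rw [he] at this
  exact this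

/-! ### The constructions -/

/-- The five chords, with the smaller end of each first. -/
def fiveChords (n : ℕ) : List (ℕ × ℕ) :=
  [(0, 2), (1, 7), (3, 6), (4, 12), bif Nat.beq n 21 then (0, 8) else (8, 21)]

theorem fiveChordGraph_eq {n : ℕ} (hn : 21 ≤ n) : fiveChordGraph n = chordGraph n (fiveChords n) := by
  ext u v
  rw [fiveChordGraph, chordGraph, SimpleGraph.fromRel_adj, SimpleGraph.fromRel_adj, fiveChords]
  rcases hn.eq_or_lt with rfl | hlt
  -- For n = 21 the last chord appears as (8, 0) on one side and (0, 8) on the other; the relation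
  -- is symmetrized, so the graphs agree.
  · simp only [Nat.mod_self, List.mem_cons, Prod.mk.injEq, List.not_mem_nil, or_false,
      show Nat.beq 21 21 = true from rfl, cond_true]
    refine and_congr_right fun _ => ?_
    constructor <;> rintro ((h | h | h | h | h | h) | (h | h | h | h | h | h)) <;> simp only [h] <;>
      simp
  · rw [show Nat.beq n 21 = false from
      Bool.eq_false_iff.2 fun h => hlt.ne' (Nat.eq_of_beq_eq_true h), cond_false,
      Nat.mod_eq_of_lt hlt]

section Constructions

set_option maxRecDepth 100000

theorem validChords_fiveChords : ∀ n ∈ List.range' 21 17, validChords n (fiveChords n) := by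
  decide +kernel

theorem allLengths_fiveChords :
    ∀ n ∈ List.range' 21 17, allLengths n (fiveChords n) [0, 3, 8] = true := by
  decide +kernel

theorem validChords_four :
    ∀ n ∈ List.range' 15 10, validChords n [(0, 2), (1, 7), (2, 5), (3, n - 6)] := by
  decide +kernel

theorem allLengths_four :
    ∀ n ∈ List.range' 15 10, allLengths n [(0, 2), (1, 7), (2, 5), (3, n - 6)] [0, 2] = true := by
  decide +kernel

theorem validChords_three :
    ∀ n ∈ List.range' 9 6, validChords n [(0, 2), (0, 4), (1, 7)] := by
  decide +kernel

theorem allLengths_three :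
    ∀ n ∈ List.range' 9 6, allLengths n [(0, 2), (0, 4), (1, 7)] [0] = true := by
  decide +kernel

theorem validChords_two : ∀ n ∈ List.range' 6 3, validChords n [(0, 2), (1, 4)] := by
  decide +kernel

theorem allLengths_two : ∀ n ∈ List.range' 6 3, allLengths n [(0, 2), (1, 4)] [1] = true := by
  decide +kernel

theorem validChords_one : ∀ n ∈ List.range' 4 2, validChords n [(0, 2)] := by
  decide +kernel

theorem allLengths_one : ∀ n ∈ List.range' 4 2, allLengths n [(0, 2)] [0] = true := by
  decide +kernel

end Constructions

end Pancyclic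

open Pancyclic

theorem mainTheorem1 :
    (minPancyclicEdges 3 = 3 ∧
      (∀ n : ℕ, 4 ≤ n → n ≤ 5 → minPancyclicEdges n = n + 1) ∧
      (∀ n : ℕ, 6 ≤ n → n ≤ 8 → minPancyclicEdges n = n + 2) ∧
      (∀ n : ℕ, 9 ≤ n → n ≤ 14 → minPancyclicEdges n = n + 3) ∧
      (∀ n : ℕ, 15 ≤ n → n ≤ 24 → minPancyclicEdges n = n + 4) ∧
      (∀ n : ℕ, 25 ≤ n → n ≤ 37 → minPancyclicEdges n = n + 5)) ∧
    (∀ n : ℕ, 21 ≤ n → n ≤ 37 →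
      IsPancyclic (fiveChordGraph n) ∧ (fiveChordGraph n).edgeSet.ncard = n + 5) := by
  refine ⟨⟨?_, fun n h1 h2 => ?_, fun n h1 h2 => ?_, fun n h1 h2 => ?_, fun n h1 h2 => ?_,
    fun n h1 h2 => ?_⟩, fun n h1 h2 => ?_⟩
  · exact minPancyclicEdges_eq (L := []) (starts := [0]) (by decide +kernel) rfl (by decide)
      (by decide +kernel) (by omega) (Or.inl rfl)
  · have hn := List.mem_range'_1.2 (show 4 ≤ n ∧ n < 4 + 2 by omega)
    exact minPancyclicEdges_eq (validChords_one n hn) rfl (by simp; omega) (allLengths_one n hn)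
      (by omega) (by omega)
  · have hn := List.mem_range'_1.2 (show 6 ≤ n ∧ n < 6 + 3 by omega)
    exact minPancyclicEdges_eq (validChords_two n hn) rfl (by simp; omega) (allLengths_two n hn)
      (by omega) (by omega)
  · have hn := List.mem_range'_1.2 (show 9 ≤ n ∧ n < 9 + 6 by omega)
    exact minPancyclicEdges_eq (validChords_three n hn) rfl (by simp; omega)
      (allLengths_three n hn) (by omega) (by omega)
  · have hn := List.mem_range'_1.2 (show 15 ≤ n ∧ n < 15 + 10 by omega)
    exact minPancyclicEdges_eq (validChords_four n hn) rfl (by simp; omega)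
      (allLengths_four n hn) (by omega) (by omega)
  -- The five chords work from n = 21 on, but they are optimal only from n = 25 on.
  · have hn := List.mem_range'_1.2 (show 21 ≤ n ∧ n < 21 + 17 by omega)
    exact minPancyclicEdges_eq (validChords_fiveChords n hn) rfl (by simp; omega)
      (allLengths_fiveChords n hn) (by omega) (by omega)
  · have hn := List.mem_range'_1.2 (show 21 ≤ n ∧ n < 21 + 17 by omega)
    rw [fiveChordGraph_eq h1]
    exact ⟨isPancyclic_chordGraph (validChords_fiveChords n hn) (by simp; omega)
      (allLengths_fiveChords n hn), ncard_edgeSet_chordGraph (validChords_fiveChords n hn)⟩
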